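/- **Setting.** A parity game with weights $\mathcal G$ consists of a finite directed graph $(V,E)$ without terminal vertices, a partition of $V$ into the positions $V_0$ of Player $0$ and $V_1$ of Player $1$, a coloring $\Omega\colon V\to\mathbb N$ and a weighting $w\colon E\to\mathbb Z$. A play is an infinite path $\rho=v_0v_1v_2\cdots$. The weight of an infix is $w(v_j\cdots v_k)=\sum_{i=j}^{k-1}w(v_i,v_{i+1})$, its amplitude is $\mathrm{Ampl}(v_j\cdots v_{j'})=\max_{j\le k\le j'}|w(v_j\cdots v_k)|$, and the cost-of-response at position $j$ is $$\mathrm{Cor}(\rho,j)=\min\{\mathrm{Ampl}(v_j\cdots v_{j'})\mid j'\ge j,\ \Omega(v_{j'})\ge\Omega(v_j),\ \Omega(v_{j'})\text{ even}\}\in\mathbb N\cup\{\infty\},\qquad \min\emptyset=\infty .$$ A strategy for Player $i$ is a map $\sigma\colon V^*V_i\to V$ with $(v,\sigma(xv))\in E$ for all $xv\in V^*V_i$; a play is consistent with $\sigma$ if $v_{j+1}=\sigma(v_0\cdots v_j)$ whenever $v_j\in V_i$. For a vertex $v^*$ let $\mathrm{Cost}_{v^*}(\sigma)=\sup_\rho\limsup_{j\to\infty}\mathrm{Cor}(\rho,j)$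 for a strategy $\sigma$ of Player $0$ and $\mathrm{Cost}_{v^*}(\tau)=\inf_\rho\limsup_{j\to\infty}\mathrm{Cor}(\rho,j)$ for a strategy $\tau$ of Player $1$, where $\rho$ ranges over the plays that start in $v^*$ and are consistent with the strategy. A memory structure $(M,\mathrm{init},\mathrm{upd})$ consists of a finite set $M$ and functions $\mathrm{init}\colon V\to M$ and $\mathrm{upd}\colon M\times E\to M$; let $\mathrm{upd}^+(v)=\mathrm{init}(v)$ and $\mathrm{upd}^+(xvv')=\mathrm{upd}(\mathrm{upd}^+(xv),(v,v'))$. It implements a strategy $\sigma$ of Player $i$ if there is $\mathrm{Nxt}\colon V_i\times M\to V$ with $(v,\mathrm{Nxt}(v,m))\in E$ for all $v,m$ and $\sigma(xv)=\mathrm{Nxt}(v,\mathrm{upd}^+(xv))$ on all play prefixes $xv$ ending in $V_i$. The strategy $\sigma$ has size $s$ if it is implemented by some memory structure with $|M|=s$. **Request functions.** Let $D$ be the set of odd colors occurring in $\mathcal G$, let $d=|D|$, and let $b\in\mathbb N$. A $b$-bounded request function is a map $r\colon D\to\{\bot\}\cup\{(l,h)\in\mathbb Z^2\mid -b\le l\le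 h\le b\}$; let $R_b$ be the set of these. The request-function memory structure has states $R_b$. Visiting a vertex $v$ transforms a request function as follows: if $\Omega(v)$ is even, all colors $c\le\Omega(v)$ are mapped to $\bot$; if $\Omega(v)$ is odd, the value at $\Omega(v)$ becomes $(0,0)$ if it was $\bot$ and $(\min\{l,0\},\max\{h,0\})$ if it was $(l,h)$; all other values are unchanged. Then $\mathrm{init}(v)$ is the result of visiting $v$ with the function that is constantly $\bot$, and $\mathrm{upd}(r,(v,v'))$ is obtained by first adding $w(v,v')$ to both components of all values $r(c)\ne\bot$, then replacing all values by $\bot$ if some pair has $l<-b$ or $h>b$, and finally visiting $v'$. **Statement.** Let $\mathcal G$ be a parity game with weights with $n$ vertices and $d$ odd colors, let $v^*$ be a vertex of $\mathcal G$ and let $b\in\mathbb N$. 1. If Player $0$ has a strategy $\sigma$ with $\mathrm{Cost}_{v^*}(\sigma)=b$, then he has a strategy $\sigma'$ with $\mathrm{Cost}_{v^*}(\sigma')\le b$ of size $(2b^2+b+2)^d$. He also has a strategy of cost at most $b$ from $v^*$ that is implemented by the request-function memory structure, which has $|R_b|=(2b^2+3b+2)^d$ states. 2. If Player $1$ has a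 strategy $\tau$ with $\mathrm{Cost}_{v^*}(\tau)=b$, then she has a strategy $\tau'$ with $\mathrm{Cost}_{v^*}(\tau')\ge b$ of size $n(2b^2+3b+2)^d$. -/

import Mathlib

open Filter

/-- An arena with vertex set `V`: a directed graph without terminal vertices whose vertices are
partitioned into the positions of Player `0` and those of Player `1`. (Finiteness of `V` is
required where arenas are used.) -/
structure Arena (V : Type*) where
  /-- the player who moves at a vertex; `V_i` is the set of vertices with owner `i` -/
  owner : V → Fin 2
  /-- the edge relation -/
  E : V → V → Prop
  nonterminal : ∀ v, ∃ v', E v v'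

namespace Arena

variable {V : Type*} (A : Arena V)

/-- The positions `V_i` of Player `i`. -/
def Pos (i : Fin 2) : Set V := {v | A.owner v = i}

/-- Plays are infinite paths. -/
def IsPlay (ρ : ℕ → V) : Prop := ∀ j, A.E (ρ j) (ρ (j + 1))

/-- A strategy for Player `i` maps every word `w v` with `w ∈ V^*` and `v ∈ V_i` to a successor
of `v`. -/
structure Strategy (i : Fin 2) where
  move : List V → A.Pos i → V
  move_edge : ∀ (w : List V) (v : A.Pos i), A.E v (move w v)

variable {A}

/-- The play `v_0 v_1 v_2 ⋯` is consistent with `σ` if `v_{j+1} = σ(v_0 ⋯ v_j)` whenever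
`v_j ∈ V_i`. -/
def Strategy.Consistent {i : Fin 2} (σ : A.Strategy i) (ρ : ℕ → V) : Prop :=
  ∀ (j : ℕ) (hj : ρ j ∈ A.Pos i), ρ (j + 1) = σ.move ((List.range j).map ρ) ⟨ρ j, hj⟩

end Arena

/-- A memory structure with set `M` of memory states. The update `upd m v v'` along the pair
`(v, v')` is only ever evaluated at edges of the arena. -/
structure MemoryStructure (V M : Type*) where
  init : V → M
  upd : M → V → V → M

namespace MemoryStructure

variable {V M : Type*} (𝓜 : MemoryStructure V M)

/-- The memory state reached from state `m` at vertex `v` by moving along the vertices of a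
list. -/
def run : M → V → List V → M
  | m, _, [] => m
  | m, v, v' :: l => run (𝓜.upd m v v') v' l

/-- The extension `upd⁺` to finite play prefixes, evaluated at the prefix `w v`. -/
def updPlus : List V → V → M
  | [], v => 𝓜.init v
  | u :: w, v => 𝓜.run (𝓜.init u) u (w ++ [v])

end MemoryStructure

namespace Arena.Strategy

variable {V : Type*} {A : Arena V} {i : Fin 2}

/-- The strategy `σ` is implemented by the memory structure `𝓜`, i.e., there is a next-move
function that, together with `𝓜`, induces `σ` on all play prefixes. -/
def ImplementedBy {M : Type*} (σ : A.Strategy i) (𝓜 : MemoryStructure V M) : Prop :=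
  ∃ Nxt : A.Pos i → M → V, (∀ (v : A.Pos i) (m : M), A.E v (Nxt v m)) ∧
    ∀ (w : List V) (v : A.Pos i), List.IsChain A.E (w ++ [(v : V)]) →
      σ.move w v = Nxt v (𝓜.updPlus w v)

/-- The strategy `σ` is a finite-state strategy of size `s`: it is implemented by a memory
structure with exactly `s` memory states. -/
def HasSize (σ : A.Strategy i) (s : ℕ) : Prop :=
  ∃ (M : Type) (_ : Finite M) (𝓜 : MemoryStructure V M), Nat.card M = s ∧ σ.ImplementedBy 𝓜

end Arena.Strategy

/-- A parity game with weights: an arena, a coloring and an edge weighting (only the weights of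
edges of the arena matter). -/
structure ParityGameWithWeights (V : Type*) extends Arena V where
  Ω : V → ℕ
  w : V → V → ℤ

namespace ParityGameWithWeights

variable {V : Type*} (G : ParityGameWithWeights V)

/-- The odd colors occurring in the game. -/
def OddColors : Set ℕ := {c | Odd c ∧ c ∈ Set.range G.Ω}

/-- The number `d` of odd colors of the game. -/
noncomputable def numOddColors : ℕ := G.OddColors.ncard

/-- The accumulated weight `w(v_j ⋯ v_k)` of an infix of a play. -/
def infixWeight (ρ : ℕ → V) (j k : ℕ) : ℤ := ∑ i ∈ Finset.Ico j k, G.w (ρ i) (ρ (i + 1))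

/-- The amplitude of the infix `v_j ⋯ v_{j'}`. -/
noncomputable def ampl (ρ : ℕ → V) (j j' : ℕ) : ℕ∞ :=
  ⨆ k ∈ Set.Icc j j', ((G.infixWeight ρ j k).natAbs : ℕ∞)

/-- The colors answering a request for color `c`. -/
def answer (c : ℕ) : Set ℕ := {c' | c ≤ c' ∧ Even c'}

/-- The cost-of-response at position `j`; it is `⊤ = ∞` if the request is never answered. -/
noncomputable def cor (ρ : ℕ → V) (j : ℕ) : ℕ∞ :=
  ⨅ j' ∈ {j' | j ≤ j' ∧ G.Ω (ρ j') ∈ answer (G.Ω (ρ j))}, G.ampl ρ j j'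

/-- The plays starting in `v` that are consistent with `σ`. -/
def outcomes {i : Fin 2} (v : V) (σ : G.Strategy i) : Set (ℕ → V) :=
  {ρ | G.IsPlay ρ ∧ ρ 0 = v ∧ σ.Consistent ρ}

/-- The cost of a strategy for Player `0` from `v`. -/
noncomputable def cost₀ (v : V) (σ : G.Strategy 0) : ℕ∞ :=
  ⨆ ρ ∈ G.outcomes v σ, limsup (G.cor ρ) atTop

/-- The cost of a strategy for Player `1` from `v`. -/
noncomputable def cost₁ (v : V) (τ : G.Strategy 1) : ℕ∞ :=
  ⨅ ρ ∈ G.outcomes v τ, limsup (G.cor ρ) atTop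

section RequestFunctions

/-- Maps from the odd colors of the game to `ℤ × ℤ`, extended by `none` for `⊥`. -/
abbrev PreRequest : Type := G.OddColors → Option (ℤ × ℤ)

variable (b : ℕ)

/-- The `b`-bounded request functions: each odd color is mapped to `⊥` (written `none`) or to a
pair `(l, h)` with `-b ≤ l ≤ h ≤ b`. -/
def RequestFunction : Type :=
  {r : G.PreRequest // ∀ c p, r c = some p → -(b : ℤ) ≤ p.1 ∧ p.1 ≤ p.2 ∧ p.2 ≤ b}

variable {G}

/-- Weight step: shift all accumulated weights by `x`. -/
def PreRequest.shift (r : G.PreRequest) (x : ℤ) : G.PreRequest :=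
  fun c => (r c).map fun p => (p.1 + x, p.2 + x)

/-- Some request has left the interval `[-b, b]`. -/
def PreRequest.Overflow (r : G.PreRequest) : Prop :=
  ∃ c p, r c = some p ∧ (p.1 < -(b : ℤ) ∨ (b : ℤ) < p.2)

open Classical in
/-- Overflow step: if some request has left `[-b, b]`, then all requests are dropped. -/
noncomputable def PreRequest.reset (r : G.PreRequest) : G.PreRequest :=
  if r.Overflow b then fun _ => none else r

/-- Request step: a visit to a vertex of even color `k` removes the requests for all colors
`c ≤ k`; a visit to a vertex of odd color `k` opens a request of weight `0` for `k`. -/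
def PreRequest.visit (r : G.PreRequest) (k : ℕ) : G.PreRequest := fun c =>
  if Even k then (if (c : ℕ) ≤ k then none else r c)
  else if (c : ℕ) = k then
    match r c with
    | none => some (0, 0)
    | some p => some (min p.1 0, max p.2 0)
  else r c

theorem PreRequest.visit_bounded (r : G.PreRequest) (k : ℕ)
    (hr : ∀ c p, r c = some p → -(b : ℤ) ≤ p.1 ∧ p.1 ≤ p.2 ∧ p.2 ≤ b) :
    ∀ c p, r.visit k c = some p → -(b : ℤ) ≤ p.1 ∧ p.1 ≤ p.2 ∧ p.2 ≤ b := by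
  intro c p h
  unfold PreRequest.visit at h
  split_ifs at h with h1 h2 h3
  · exact hr c p h
  · cases hc : r c with
    | none =>
      rw [hc] at h
      simp only [Option.some.injEq] at h
      subst h
      simp
    | some q =>
      rw [hc] at h
      simp only [Option.some.injEq] at h
      subst h
      have := hr c q hc
      refine ⟨?_, ?_, ?_⟩ <;> simp only [] <;> omega
  · exact hr c p h

theorem PreRequest.reset_shift_bounded (r : G.PreRequest) (x : ℤ)
    (hr : ∀ c p, r c = some p → -(b : ℤ) ≤ p.1 ∧ p.1 ≤ p.2 ∧ p.2 ≤ b) :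
    ∀ c p, (r.shift x).reset b c = some p → -(b : ℤ) ≤ p.1 ∧ p.1 ≤ p.2 ∧ p.2 ≤ b := by
  intro c p h
  unfold PreRequest.reset at h
  split_ifs at h with h1
  have h2 : ¬(p.1 < -(b : ℤ) ∨ (b : ℤ) < p.2) := fun h3 => h1 ⟨c, p, h, h3⟩
  unfold PreRequest.shift at h
  obtain ⟨q, hq, hqp⟩ := Option.map_eq_some_iff.mp h
  have h4 := hr c q hq
  subst hqp
  simp only [] at h2 ⊢
  omega

variable (G)

/-- The memory structure whose states are the `b`-bounded request functions. -/
noncomputable def requestMemory : MemoryStructure V (G.RequestFunction b) where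
  init v := ⟨PreRequest.visit (fun _ => none) (G.Ω v),
    PreRequest.visit_bounded b _ _ (fun _ _ h => by simp at h)⟩
  upd r v v' := ⟨((r.1.shift (G.w v v')).reset b).visit (G.Ω v'),
    PreRequest.visit_bounded b _ _ (PreRequest.reset_shift_bounded b _ _ r.2)⟩

end RequestFunctions

end ParityGameWithWeights

universe u

/-! ### Eventual behavior of sequences and parity conditions. -/

theorem eventually_atTop_add_iff (p : ℕ → Prop) (k : ℕ) :
    (∀ᶠ j in atTop, p (j + k)) ↔ ∀ᶠ j in atTop, p j := by
  rw [← Filter.eventually_map (m := fun j => j + k) (P := p), map_add_atTop_eq_nat]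

/-- A sequence in a well-order that is eventually nonincreasing is eventually constant. -/
theorem eventually_const_of_nonincreasing {α : Type*} [LinearOrder α] [WellFoundedLT α]
    (u : ℕ → α) (h : ∀ᶠ n in atTop, u (n + 1) ≤ u n) : ∃ a, ∀ᶠ n in atTop, u n = a := by
  obtain ⟨n₀, h₀⟩ := eventually_atTop.mp h
  obtain ⟨_, ⟨n₁, h₁, rfl⟩, hmin⟩ := WellFounded.has_min (wellFounded_lt (α := α))
    (u '' Set.Ici n₀) ⟨u n₀, n₀, Set.self_mem_Ici, rfl⟩
  refine ⟨u n₁, eventually_atTop.mpr ⟨n₁, fun n hn => ?_⟩⟩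
  have h₁' : n₀ ≤ n₁ := h₁
  refine le_antisymm ?_ (not_lt.mp (hmin (u n) ⟨n, h₁'.trans hn, rfl⟩))
  induction n, hn using Nat.le_induction with
  | base => exact le_refl _
  | succ n hn ih => exact (h₀ n (h₁'.trans hn)).trans ih

/-- The limit superior of the sequence is not an odd number. -/
def EvenLimsup (s : ℕ → ℕ) : Prop :=
  ∀ c, Odd c → (∀ᶠ j in atTop, s j ≤ c) → ∀ᶠ j in atTop, s j ≠ c

theorem evenLimsup_shift_iff (s : ℕ → ℕ) (k : ℕ) :
    EvenLimsup (fun j => s (j + k)) ↔ EvenLimsup s := by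
  unfold EvenLimsup
  refine forall_congr' fun c => ?_
  rw [eventually_atTop_add_iff (fun j => s j ≤ c), eventually_atTop_add_iff (fun j => s j ≠ c)]

theorem EvenLimsup.congr {s t : ℕ → ℕ} (h : EvenLimsup s) (hst : ∀ᶠ j in atTop, s j = t j) :
    EvenLimsup t := by
  intro c hc hle
  have h1 : ∀ᶠ j in atTop, s j ≤ c := by
    filter_upwards [hst, hle] with j h1 h2
    omega
  filter_upwards [hst, h c hc h1] with j h1 h2
  omega

theorem exists_limsup_of_bounded {s : ℕ → ℕ} {N : ℕ} (h : ∀ j, s j ≤ N) :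
    ∃ e, (∀ᶠ j in atTop, s j ≤ e) ∧ ∃ᶠ j in atTop, s j = e := by
  classical
  have hex : ∃ e, ∀ᶠ j in atTop, s j ≤ e := ⟨N, Eventually.of_forall h⟩
  refine ⟨Nat.find hex, Nat.find_spec hex, fun hne => ?_⟩
  have hlt : ∀ᶠ j in atTop, s j < Nat.find hex := by
    filter_upwards [hne, Nat.find_spec hex] with j h1 h2
    exact lt_of_le_of_ne h2 h1
  obtain ⟨j, hj⟩ := hlt.exists
  refine Nat.find_min hex (m := Nat.find hex - 1) (by omega) ?_
  filter_upwards [hlt] with j hj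
  omega

/-- Adding one flips the parity of the limit superior, so the opponent's objective is again a parity
condition. -/
theorem EvenLimsup.succ_of_not {s : ℕ → ℕ} (h : ¬ EvenLimsup s) :
    EvenLimsup fun j => s j + 1 := by
  unfold EvenLimsup at h
  push Not at h
  obtain ⟨c, hc, hle, hfr⟩ := h
  intro c' hc' hle'
  obtain ⟨j, h1, h2⟩ := (hfr.and_eventually hle').exists
  filter_upwards [hle] with j h3 h4
  dsimp only at h2 h4
  obtain ⟨a, rfl⟩ := hc
  obtain ⟨a', rfl⟩ := hc'
  omega

/-- Boundedness is essential: an unbounded sequence satisfies `EvenLimsup` both before and after the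
shift. -/
theorem EvenLimsup.not_of_succ {s : ℕ → ℕ} {N : ℕ} (hN : ∀ j, s j ≤ N)
    (h : EvenLimsup fun j => s j + 1) : ¬ EvenLimsup s := by
  intro h'
  obtain ⟨e, hle, hfr⟩ := exists_limsup_of_bounded hN
  rcases Nat.even_or_odd e with he | he
  · refine hfr ((h (e + 1) he.add_one (hle.mono fun j hj => Nat.succ_le_succ hj)).mono
      fun j hj hj' => hj (congrArg Nat.succ hj'))
  · exact hfr (h' e he hle)

/-! ### Ordinal ranks and positional choices for parity conditions. -/

/-- If no infinite path of `R` takes infinitely many steps in `S`, then some ordinal-valued rank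
is nonincreasing along `R` and decreases along the steps in `S`. -/
theorem exists_rank {α : Type u} (R S : α → α → Prop)
    (h : ∀ f : ℕ → α, (∀ n, R (f n) (f (n + 1))) → ∀ᶠ n in atTop, ¬ S (f n) (f (n + 1))) :
    ∃ θ : α → Ordinal.{u}, (∀ a b, R a b → θ b ≤ θ a) ∧ ∀ a b, R a b → S a b → θ b < θ a := by
  classical
  -- The rank will be the well-founded rank of "reachable by a path ending in an `S`-step".
  -- Prefixing an `R`-step can only add such targets, hence monotonicity.
  let T : α → α → Prop := fun b a => ∃ x, Relation.ReflTransGen R a x ∧ R x b ∧ S x b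
  have hwf : WellFounded T := by
    by_contra hnot
    let bad : α → Prop := fun a => ¬ Acc T a
    obtain ⟨a₀, ha₀⟩ : ∃ a, bad a := by
      by_contra hall
      push Not at hall
      exact hnot ⟨fun a => not_not.mp (hall a)⟩
    let P : ℕ → α → Prop := fun n =>
      Nat.rec (motive := fun _ => α → Prop) (fun a => ∃ b, R a b ∧ S a b ∧ bad b) 
        (fun _ p a => ∃ a', R a a' ∧ p a') n
    have hP : ∀ a, bad a → ∃ n, P n a := by
      intro a ha
      obtain ⟨b, ⟨x, hax, hxb, hS⟩, hb⟩ : ∃ b, T b a ∧ bad b := by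
        by_contra hno
        push Not at hno
        exact ha ⟨a, fun b hb => not_not.mp (hno b hb)⟩
      clear ha
      induction hax using Relation.ReflTransGen.head_induction_on with
      | refl => exact ⟨0, b, hxb, hS, hb⟩
      | head hstep _ ih =>
        obtain ⟨n, hn⟩ := ih
        exact ⟨n + 1, _, hstep, hn⟩
    have hbad : ∀ n a, P n a → ∃ b, T b a ∧ bad b := by
      intro n
      induction n with
      | zero =>
        rintro a ⟨b, h1, h2, h3⟩
        exact ⟨b, ⟨a, .refl, h1, h2⟩, h3⟩
      | succ n ih =>
        rintro a ⟨a', h1, h2⟩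
        obtain ⟨b, ⟨x, h3, h4, h5⟩, h6⟩ := ih a' h2
        exact ⟨b, ⟨x, .head h1 h3, h4, h5⟩, h6⟩
    -- The distance to the next `S`-step into a bad point. Each step from a bad point either is such
    -- a step or lowers the distance, so following `next` takes infinitely many `S`-steps.
    let dist : {a // bad a} → ℕ := fun a => Nat.find (hP a.1 a.2)
    have hstep : ∀ a : {a // bad a}, ∃ a' : {a // bad a}, R a a' ∧
        (S a a' ∨ dist a' < dist a) := by
      rintro ⟨a, ha⟩
      have hs := Nat.find_spec (hP a ha)
      cases hn : Nat.find (hP a ha) with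
      | zero =>
        rw [hn] at hs
        obtain ⟨b, h1, h2, h3⟩ := hs
        exact ⟨⟨b, h3⟩, h1, Or.inl h2⟩
      | succ n =>
        rw [hn] at hs
        obtain ⟨a', h1, h2⟩ := hs
        obtain ⟨b, h3, h4⟩ := hbad n a' h2
        have ha' : bad a' := fun hacc => h4 (hacc.inv h3)
        refine ⟨⟨a', ha'⟩, h1, Or.inr ?_⟩
        exact (Nat.lt_succ_of_le (Nat.find_min' (hP a' ha') h2)).trans_eq hn.symm
    choose next hR hnext using hstep
    let f : ℕ → {a // bad a} := fun n => next^[n] ⟨a₀, ha₀⟩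
    have hf : ∀ n, f (n + 1) = next (f n) := fun n => Function.iterate_succ_apply' next n _
    obtain ⟨n₀, hn₀⟩ := eventually_atTop.mp (h (fun n => (f n : α)) (fun n => by
      rw [hf]
      exact hR _))
    have hdec : ∀ k, dist (f (n₀ + k)) + k
        ≤ dist (f n₀) := by
      intro k
      induction k with
      | zero => exact le_refl _
      | succ k ih =>
        have h1 := hn₀ (n₀ + k) (by omega)
        have h2 := hnext (f (n₀ + k))
        rw [← hf] at h2
        have h3 := h2.resolve_left h1
        have h4 : n₀ + (k + 1) = n₀ + k + 1 := rfl
        rw [h4]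
        omega
    have := hdec (dist (f n₀) + 1)
    omega
  have : IsWellFounded α T := ⟨hwf⟩
  refine ⟨IsWellFounded.rank T, fun a b hab => ?_, fun a b hab hS =>
    IsWellFounded.rank_lt_of_rel ⟨a, .refl, hab, hS⟩⟩
  rw [IsWellFounded.rank_eq T b]
  refine Ordinal.iSup_le ?_
  rintro ⟨z, x, h1, h2, h3⟩
  exact Order.succ_le_of_lt (IsWellFounded.rank_lt_of_rel ⟨x, .head hab h1, h2, h3⟩)

/-- Cutting off the less significant entries is monotone in the lexicographic order. -/
theorem monotone_lex_truncate {N : ℕ} (p : Fin N → Prop) [DecidablePred p]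
    (hp : ∀ i j, i ≤ j → p j → p i) :
    Monotone fun x : Lex (Fin N → Ordinal) =>
      toLex (fun i => if p i then ofLex x i else 0) := by
  intro x y hxy
  rcases hxy.eq_or_lt with rfl | hlt
  · exact le_refl _
  obtain ⟨i, hi, hlt⟩ := hlt
  by_cases hpi : p i
  · refine le_of_lt ⟨i, fun j hj => ?_, ?_⟩
    · have := hi j hj
      simp only [Pi.toLex_apply]
      split_ifs
      · exact this
      · rfl
    · simp only [Pi.toLex_apply, hpi, if_true]
      exact hlt
  · refine le_of_eq (congrArg toLex (funext fun j => ?_))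
    by_cases hj : j < i
    · have := hi j hj
      split_ifs
      · exact this
      · rfl
    · rw [if_neg (fun h => hpi (hp i j (not_lt.mp hj) h)),
        if_neg (fun h => hpi (hp i j (not_lt.mp hj) h))]

/-- If all infinite paths through a set of histories satisfy a parity condition that depends only
on the states of the histories, then there are representatives of the states such that all paths
obtained by moving from representative to representative satisfy the parity condition, too. -/
theorem exists_representatives {H : Type u} {Q : Type*} (R : H → H → Prop) (st : H → Q)
    (prio : Q → Q → ℕ) {N : ℕ} (hN : ∀ q q', prio q q' ≤ N)
    (h : ∀ f : ℕ → H, (∀ n, R (f n) (f (n + 1))) →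
      EvenLimsup fun n => prio (st (f n)) (st (f (n + 1)))) :
    ∃ rep : Set.range st → H, (∀ q, st (rep q) = q) ∧
      ∀ g : ℕ → Set.range st, (∀ n, ∃ h', R (rep (g n)) h' ∧ st h' = g (n + 1)) →
        EvenLimsup fun n => prio (g n) (g (n + 1)) := by
  classical
  have hθ : ∀ c, ∃ θ : H → Ordinal.{u}, ∀ a b, R a b →
      (prio (st a) (st b) ≤ c → θ b ≤ θ a) ∧ (Odd c → prio (st a) (st b) = c → θ b < θ a) := by
    intro c
    by_cases hc : Odd c
    · obtain ⟨θ, h1, h2⟩ := exists_rank (fun a b => R a b ∧ prio (st a) (st b) ≤ c)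
        (fun a b => prio (st a) (st b) = c)
        (fun f hf => h f (fun n => (hf n).1) c hc (Eventually.of_forall fun n => (hf n).2))
      exact ⟨θ, fun a b hab => ⟨fun hle => h1 a b ⟨hab, hle⟩,
        fun _ heq => h2 a b ⟨hab, heq.le⟩ heq⟩⟩
    · exact ⟨fun _ => 0, fun a b hab => ⟨fun _ => le_refl _, fun hc' => absurd hc' hc⟩⟩
  choose θ hθ using hθ
  -- The index `N - i` makes the largest priority the most significant one.
  let Θ : H → Lex (Fin (N + 1) → Ordinal.{u}) := fun a => toLex fun i => θ (N - i) a
  have hmin : ∀ q : Set.range st, ∃ a, st a = q ∧ ∀ b, st b = q → Θ a ≤ Θ b := by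
    rintro ⟨_, a, rfl⟩
    obtain ⟨_, ⟨m, hm, rfl⟩, hmin⟩ := WellFounded.has_min
      (wellFounded_lt (α := Lex (Fin (N + 1) → Ordinal.{u}))) (Θ '' {b | st b = st a})
      ⟨_, a, rfl, rfl⟩
    exact ⟨m, hm, fun b hb => not_lt.mp (hmin _ ⟨b, hb, rfl⟩)⟩
  choose rep hrep hmin using hmin
  refine ⟨rep, hrep, fun g hg c hc hle => ?_⟩
  choose nx hnx hst using hg
  by_cases hcN : N < c
  · exact Eventually.of_forall fun n => ((hN (g n) (g (n + 1))).trans_lt hcN).ne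
  let p : Fin (N + 1) → Prop := fun i => c ≤ N - i
  -- Only the ranks of priorities at least `c` are kept. While priorities stay at most `c`, none of
  -- them increases along a step; at priority `c` the one for `c` drops; passing to the
  -- representative does not increase the truncated tuple.
  let tr : Lex (Fin (N + 1) → Ordinal.{u}) → Lex (Fin (N + 1) → Ordinal.{u}) :=
    fun x => toLex (fun i => if p i then ofLex x i else 0)
  have htr : Monotone tr := monotone_lex_truncate p (fun i j hij hj => by
    have : (i : ℕ) ≤ j := hij
    simp only [p] at hj ⊢
    omega)
  have h1 : ∀ n, tr (Θ (rep (g (n + 1)))) ≤ tr (Θ (nx n)) :=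
    fun n => htr (hmin _ _ (hst n))
  have h2 : ∀ n, prio (g n) (g (n + 1)) ≤ c → tr (Θ (nx n)) ≤ tr (Θ (rep (g n))) := by
    intro n hn
    refine Pi.toLex_monotone fun i => ?_
    by_cases hp : p i
    · simp only [hp, if_true]
      refine (hθ _ _ _ (hnx n)).1 ?_
      rw [hrep, hst]
      exact hn.trans hp
    · simp [hp]
  have h3 : ∀ n, prio (g n) (g (n + 1)) = c → tr (Θ (nx n)) < tr (Θ (rep (g n))) := by
    intro n hn
    refine lt_of_le_of_ne (h2 n hn.le) fun heq => ?_
    have h4 := congrFun (congrArg ofLex heq) ⟨N - c, by omega⟩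
    have h5 : p ⟨N - c, by omega⟩ := by simp only [p]; omega
    have h6 : N - (N - c) = c := by omega
    simp only [tr, h5, if_true, Θ, ofLex_toLex, h6] at h4
    refine absurd h4 (ne_of_lt ((hθ c _ _ (hnx n)).2 hc ?_))
    rw [hrep, hst]
    exact hn
  obtain ⟨a, ha⟩ := eventually_const_of_nonincreasing (fun n => tr (Θ (rep (g n))))
    (hle.mono fun n hn => (h1 n).trans (h2 n hn))
  filter_upwards [ha, (eventually_atTop_add_iff _ 1).mpr ha] with n hn hn' heq
  exact absurd (hn'.trans hn.symm) (ne_of_lt ((h1 n).trans_lt (h3 n heq)))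

/-- Prolonging an infinite path to the left. -/
theorem exists_path_of_reflTransGen {α : Type*} {R : α → α → Prop} {a b : α}
    (hab : Relation.ReflTransGen R a b) (f : ℕ → α) (h0 : f 0 = b)
    (hf : ∀ n, R (f n) (f (n + 1))) :
    ∃ (g : ℕ → α) (k : ℕ), g 0 = a ∧ (∀ n, R (g n) (g (n + 1))) ∧ ∀ n, g (n + k) = f n := by
  induction hab using Relation.ReflTransGen.head_induction_on with
  | refl => exact ⟨f, 0, h0, hf, fun n => rfl⟩
  | @head a c hstep _ ih =>
    obtain ⟨g, k, hg0, hg, hgk⟩ := ih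
    refine ⟨fun n => Nat.casesOn n a g, k + 1, rfl, ?_, hgk⟩
    intro n
    cases n with
    | zero => simpa [hg0] using hstep
    | succ n => exact hg n

/-! ### Positional strategies in the product with a memory structure. -/

namespace MemoryStructure

variable {V M : Type*} (𝓜 : MemoryStructure V M)

theorem run_append (m : M) (u : V) (w : List V) (v v' : V) :
    𝓜.run m u (w ++ [v, v']) = 𝓜.upd (𝓜.run m u (w ++ [v])) v v' := by
  induction w generalizing m u with
  | nil => rfl
  | cons x w ih => exact ih _ _

theorem updPlus_append (w : List V) (v v' : V) :
    𝓜.updPlus (w ++ [v]) v' = 𝓜.upd (𝓜.updPlus w v) v v' := by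
  cases w with
  | nil => rfl
  | cons u w =>
    have := 𝓜.run_append (𝓜.init u) u w v v'
    simpa [updPlus] using this

/-- The memory state reached at position `j` of a play. -/
def along (ρ : ℕ → V) (j : ℕ) : M := 𝓜.updPlus ((List.range j).map ρ) (ρ j)

theorem along_zero (ρ : ℕ → V) : 𝓜.along ρ 0 = 𝓜.init (ρ 0) := rfl

theorem along_succ (ρ : ℕ → V) (j : ℕ) :
    𝓜.along ρ (j + 1) = 𝓜.upd (𝓜.along ρ j) (ρ j) (ρ (j + 1)) := by
  simp only [along, List.range_succ, List.map_append, List.map_cons, List.map_nil]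
  exact 𝓜.updPlus_append _ _ _

end MemoryStructure

namespace Arena

variable {V M : Type*} (A : Arena V) {i : Fin 2}

/-- The moves from `v` that are compatible with the next-move function in memory state `m`. -/
def Allowed (Nxt : A.Pos i → M → V) (v : V) (m : M) (v' : V) : Prop :=
  A.E v v' ∧ ∀ hv : v ∈ A.Pos i, v' = Nxt ⟨v, hv⟩ m

variable {A}

/-- The strategy given by a memory structure and a next-move function. -/
def Strategy.ofMemory (𝓜 : MemoryStructure V M) (Nxt : A.Pos i → M → V)
    (h : ∀ (v : A.Pos i) m, A.E v (Nxt v m)) : A.Strategy i where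
  move w v := Nxt v (𝓜.updPlus w v)
  move_edge _ v := h v _

theorem Strategy.ofMemory_implementedBy (𝓜 : MemoryStructure V M) (Nxt : A.Pos i → M → V)
    (h : ∀ (v : A.Pos i) m, A.E v (Nxt v m)) : (Strategy.ofMemory 𝓜 Nxt h).ImplementedBy 𝓜 :=
  ⟨Nxt, h, fun _ _ _ => rfl⟩

theorem Strategy.Consistent.allowed {𝓜 : MemoryStructure V M} {Nxt : A.Pos i → M → V}
    {h : ∀ (v : A.Pos i) m, A.E v (Nxt v m)} {ρ : ℕ → V} (hplay : A.IsPlay ρ)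
    (hρ : (Strategy.ofMemory 𝓜 Nxt h).Consistent ρ) (j : ℕ) :
    A.Allowed Nxt (ρ j) (𝓜.along ρ j) (ρ (j + 1)) :=
  ⟨hplay j, fun hj => hρ j hj⟩

/-- A parity condition on the product of an arena with a memory structure that can be enforced by
some strategy can be enforced by one that is positional in the product. -/
theorem exists_positional_in_product (σ : A.Strategy i) (𝓜 : MemoryStructure V M)
    (prio : V × M → V → ℕ) {N : ℕ} (hN : ∀ q v', prio q v' ≤ N) (v₀ : V)
    (h : ∀ ρ, A.IsPlay ρ → ρ 0 = v₀ → σ.Consistent ρ →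
      EvenLimsup fun j => prio (ρ j, 𝓜.along ρ j) (ρ (j + 1))) :
    ∃ (Nxt : A.Pos i → M → V) (W : Set (V × M)), (∀ (v : A.Pos i) m, A.E v (Nxt v m)) ∧
      (v₀, 𝓜.init v₀) ∈ W ∧
      (∀ v m v', (v, m) ∈ W → A.Allowed Nxt v m v' → (v', 𝓜.upd m v v') ∈ W) ∧
      ∀ (ρ : ℕ → V) (m : ℕ → M), (∀ j, (ρ j, m j) ∈ W) →
        (∀ j, A.Allowed Nxt (ρ j) (m j) (ρ (j + 1))) →
        (∀ j, m (j + 1) = 𝓜.upd (m j) (ρ j) (ρ (j + 1))) →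
        EvenLimsup fun j => prio (ρ j, m j) (ρ (j + 1)) := by
  classical
  let step : List V × V → List V × V → Prop := fun a b =>
    b.1 = a.1 ++ [a.2] ∧ A.E a.2 b.2 ∧ ∀ ha : a.2 ∈ A.Pos i, b.2 = σ.move a.1 ⟨a.2, ha⟩
  let H := {a // Relation.ReflTransGen step ([], v₀) a}
  let st : H → V × M := fun a => (a.1.2, 𝓜.updPlus a.1.1 a.1.2)
  obtain ⟨rep, hrep, hgood⟩ := exists_representatives (fun a b : H => step a.1 b.1) st
    (fun q q' => prio q q'.1) (fun q q' => hN q q'.1) (by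
      intro f hf
      -- A path of histories may start in the middle of a play; prolonging it back to `v₀` makes the
      -- hypothesis on plays applicable.
      obtain ⟨g, k, hg0, hg, hgk⟩ := exists_path_of_reflTransGen (f 0).2 (fun n => (f n).1) rfl hf
      have hg1 : ∀ n, (g n).1 = (List.range n).map fun j => (g j).2 := by
        intro n
        induction n with
        | zero => rw [hg0]; rfl
        | succ n ih => rw [(hg n).1, ih, List.range_succ, List.map_append]; rfl
      have hE := h (fun n => (g n).2) (fun n => (hg n).2.1) (by rw [hg0]) (fun n hn => by
        refine ((hg n).2.2 hn).trans ?_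
        rw [hg1 n])
      rw [← evenLimsup_shift_iff _ k] at hE
      refine hE.congr (Eventually.of_forall fun n => ?_)
      have h1 : n + k + 1 = n + 1 + k := by omega
      simp only [st, MemoryStructure.along]
      rw [h1, ← hg1, hgk, hgk])
  -- Play `σ` as if the history were the representative of the current state; unreached states get
  -- an arbitrary successor.
  refine ⟨fun v m => if hq : ((v : V), m) ∈ Set.range st then σ.move (rep ⟨_, hq⟩).1.1 v
    else (A.nonterminal v).choose, Set.range st, ?_, ?_, ?_, ?_⟩
  · intro v m
    dsimp only
    split_ifs with hq
    · exact σ.move_edge _ v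
    · exact (A.nonterminal v).choose_spec
  · exact ⟨⟨([], v₀), .refl⟩, rfl⟩
  all_goals
    have key : ∀ v m v' (hq : (v, m) ∈ Set.range st), A.Allowed (fun v m =>
        if hq : ((v : V), m) ∈ Set.range st then σ.move (rep ⟨_, hq⟩).1.1 v
        else (A.nonterminal v).choose) v m v' →
        ∃ b : H, step (rep ⟨_, hq⟩).1 b.1 ∧ st b = (v', 𝓜.upd m v v') := by
      intro v m v' hq hal
      have hst := hrep ⟨_, hq⟩
      have hv : (rep ⟨_, hq⟩).1.2 = v := congrArg Prod.fst hst
      have hm : 𝓜.updPlus (rep ⟨_, hq⟩).1.1 (rep ⟨_, hq⟩).1.2 = m := congrArg Prod.snd hst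
      have hstep : step (rep ⟨_, hq⟩).1 ((rep ⟨_, hq⟩).1.1 ++ [(rep ⟨_, hq⟩).1.2], v') := by
        refine ⟨rfl, ?_, fun ha => ?_⟩
        · rw [hv]
          exact hal.1
        · have ha' : v ∈ A.Pos i := hv ▸ ha
          have h1 := hal.2 ha'
          simp only [dif_pos hq] at h1
          simp only [h1, hv]
      refine ⟨⟨_, (rep ⟨_, hq⟩).2.tail hstep⟩, hstep, ?_⟩
      simp only [st]
      rw [𝓜.updPlus_append, hm, hv]
  · intro v m v' hq hal
    obtain ⟨b, -, hb⟩ := key v m v' hq hal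
    exact ⟨b, hb⟩
  · intro ρ m hq hal hm
    refine hgood (fun n => ⟨(ρ n, m n), hq n⟩) (fun n => ?_)
    obtain ⟨b, hb, hb'⟩ := key _ _ _ (hq n) (hal n)
    exact ⟨b, hb, hb'.trans (Prod.ext rfl (hm n).symm)⟩

end Arena

/-! ### Bounded costs as a parity condition on runs of the request memory. -/

/-- Containment of intervals, where `none` is the empty interval. -/
def IntervalLe (x y : Option (ℤ × ℤ)) : Prop :=
  ∀ p, x = some p → ∃ q, y = some q ∧ q.1 ≤ p.1 ∧ p.2 ≤ q.2

theorem IntervalLe.refl (x : Option (ℤ × ℤ)) : IntervalLe x x :=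
  fun p hp => ⟨p, hp, le_refl _, le_refl _⟩

theorem IntervalLe.trans {x y z : Option (ℤ × ℤ)} (hxy : IntervalLe x y) (hyz : IntervalLe y z) :
    IntervalLe x z := by
  intro p hp
  obtain ⟨q, hq, h1, h2⟩ := hxy p hp
  obtain ⟨q', hq', h3, h4⟩ := hyz q hq
  exact ⟨q', hq', h3.trans h1, h2.trans h4⟩

namespace ParityGameWithWeights

variable {V : Type*} (G : ParityGameWithWeights V)

theorem infixWeight_self (ρ : ℕ → V) (j : ℕ) : G.infixWeight ρ j j = 0 := by
  simp [infixWeight]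

theorem infixWeight_succ (ρ : ℕ → V) {j k : ℕ} (h : j ≤ k) :
    G.infixWeight ρ j (k + 1) = G.infixWeight ρ j k + G.w (ρ k) (ρ (k + 1)) :=
  Finset.sum_Ico_succ_top h _

/-- The position `l` answers the request posed at position `i`. -/
def Answers (ρ : ℕ → V) (i l : ℕ) : Prop := G.Ω (ρ l) ∈ answer (G.Ω (ρ i))

variable {G} {b : ℕ}

theorem cor_le_of {ρ : ℕ → V} {i j : ℕ} (hij : i ≤ j) (hj : G.Answers ρ i j)
    (h : ∀ k, i ≤ k → k ≤ j → (G.infixWeight ρ i k).natAbs ≤ b) : G.cor ρ i ≤ b := by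
  refine (iInf₂_le j ⟨hij, hj⟩).trans (iSup₂_le fun k hk => ?_)
  exact_mod_cast h k hk.1 hk.2

/-- The amplitude includes the answering position, so a large weight at `j` counts even if `j` is
the first answer. -/
theorem lt_cor_of {ρ : ℕ → V} {i j : ℕ} (hij : i ≤ j) (h : ∀ l, i ≤ l → l < j → ¬ G.Answers ρ i l)
    (hb : b < (G.infixWeight ρ i j).natAbs) : (b : ℕ∞) < G.cor ρ i := by
  have h1 : ((b + 1 : ℕ) : ℕ∞) ≤ G.cor ρ i := by
    refine le_iInf₂ fun j' hj' => ?_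
    have hjj' : j ≤ j' := not_lt.mp fun hlt => h j' hj'.1 hlt hj'.2
    refine le_trans ?_ (le_iSup₂ (f := fun k (_ : k ∈ Set.Icc i j') =>
      ((G.infixWeight ρ i k).natAbs : ℕ∞)) j ⟨hij, hjj'⟩)
    exact_mod_cast hb
  exact lt_of_lt_of_le (by exact_mod_cast Nat.lt_succ_self b) h1

theorem exists_answer_of_cor_le {ρ : ℕ → V} {i : ℕ} (h : G.cor ρ i ≤ b) :
    ∃ j, i ≤ j ∧ G.Answers ρ i j := by
  by_contra hno
  push Not at hno
  have : G.cor ρ i = ⊤ := by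
    refine iInf₂_eq_top.mpr fun j hj => absurd hj.2 (hno j hj.1)
  rw [this] at h
  exact absurd h (by simp)

theorem limsup_cor_le_iff (ρ : ℕ → V) :
    limsup (G.cor ρ) atTop ≤ b ↔ ∀ᶠ i in atTop, G.cor ρ i ≤ b := by
  constructor
  · intro h
    have h1 : limsup (G.cor ρ) atTop < (b : ℕ∞) + 1 :=
      lt_of_le_of_lt h (by exact_mod_cast Nat.lt_succ_self b)
    exact (eventually_lt_of_limsup_lt h1).mono fun i hi =>
      (ENat.lt_add_one_iff (ENat.natCast_ne_top b)).mp hi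
  · exact fun h => limsup_le_of_le (h := h)

namespace PreRequest

theorem visit_self (r : G.PreRequest) {k : ℕ} (hk : Odd k) (c : G.OddColors) (hc : (c : ℕ) = k) :
    ∃ p, r.visit k c = some p ∧ p.1 ≤ 0 ∧ 0 ≤ p.2 := by
  unfold visit
  rw [if_neg (Nat.not_even_iff_odd.mpr hk), if_pos hc]
  cases r c with
  | none => exact ⟨_, rfl, le_refl _, le_refl _⟩
  | some p => exact ⟨_, rfl, min_le_right _ _, le_max_right _ _⟩

theorem le_visit (r : G.PreRequest) {k : ℕ} (c : G.OddColors) (hk : ¬ (Even k ∧ (c : ℕ) ≤ k)) :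
    IntervalLe (r c) (r.visit k c) := by
  intro p hp
  unfold visit
  split_ifs with h1 h2 h3
  · exact absurd ⟨h1, h2⟩ hk
  · exact ⟨p, hp, le_refl _, le_refl _⟩
  · rw [hp]
    exact ⟨_, rfl, min_le_left _ _, le_max_left _ _⟩
  · exact ⟨p, hp, le_refl _, le_refl _⟩

theorem shift_eq_some {r : G.PreRequest} {x : ℤ} {c : G.OddColors} {p : ℤ × ℤ}
    (h : r.shift x c = some p) : ∃ q, r c = some q ∧ p = (q.1 + x, q.2 + x) := by
  obtain ⟨q, hq, rfl⟩ := Option.map_eq_some_iff.mp h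
  exact ⟨q, hq, rfl⟩

theorem shift_of_eq_some {r : G.PreRequest} (x : ℤ) {c : G.OddColors} {p : ℤ × ℤ}
    (h : r c = some p) : r.shift x c = some (p.1 + x, p.2 + x) := by
  simp [shift, h]

theorem reset_of_not_overflow {r : G.PreRequest} (h : ¬ r.Overflow b) : r.reset b = r :=
  if_neg h

end PreRequest

/-- If eventually the request functions keep track of all requests without exceeding the bound,
and if the parity condition is satisfied, then almost all costs-of-response are bounded. -/
theorem eventually_cor_le {ρ : ℕ → V} (r : ℕ → G.PreRequest) {B : ℕ} (hB : ∀ v, G.Ω v ≤ B)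
    (hno : ∀ᶠ j in atTop, ¬ ((r j).shift (G.w (ρ j) (ρ (j + 1)))).Overflow b)
    (hstep : ∀ᶠ j in atTop, ∀ c, IntervalLe
      (((r j).shift (G.w (ρ j) (ρ (j + 1)))).visit (G.Ω (ρ (j + 1))) c) (r (j + 1) c))
    (hpar : EvenLimsup fun j => G.Ω (ρ j)) : ∀ᶠ i in atTop, G.cor ρ i ≤ b := by
  classical
  obtain ⟨e, he, hfr⟩ := exists_limsup_of_bounded (s := fun j => G.Ω (ρ j)) fun j => hB (ρ j)
  have heven : Even e := by
    by_contra hodd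
    exact hfr (hpar e (Nat.not_even_iff_odd.mp hodd) he)
  obtain ⟨s, hs⟩ := eventually_atTop.mp (hno.and (hstep.and he))
  refine eventually_atTop.mpr ⟨s + 1, fun i hi => ?_⟩
  obtain ⟨i, rfl⟩ : ∃ i', i = i' + 1 := ⟨i - 1, by omega⟩
  have hex : ∃ j, i + 1 ≤ j ∧ G.Answers ρ (i + 1) j := by
    obtain ⟨j, hj, hje⟩ := (frequently_atTop.mp hfr) (i + 1)
    refine ⟨j, hj, ?_⟩
    have := (hs (i + 1) (by omega)).2.2
    exact ⟨by omega, by rw [hje]; exact heven⟩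
  have hmin : ∀ l, i + 1 ≤ l → l < Nat.find hex → ¬ G.Answers ρ (i + 1) l :=
    fun l h1 h2 h3 => Nat.find_min hex h2 ⟨h1, h3⟩
  -- Until it is answered, the request stays recorded in an interval containing its true weight.
  -- Absence of overflow, which is tested before the answering visit, then bounds that weight up to
  -- and including the answer.
  have claim : ∀ k, i + 1 ≤ k → k < Nat.find hex → ∃ (c : G.OddColors) (p : ℤ × ℤ),
      (c : ℕ) = G.Ω (ρ (i + 1)) ∧ r k c = some p ∧ p.1 ≤ G.infixWeight ρ (i + 1) k ∧
      G.infixWeight ρ (i + 1) k ≤ p.2 := by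
    intro k hk
    induction k, hk using Nat.le_induction with
    | base =>
      intro hlt
      have hodd : Odd (G.Ω (ρ (i + 1))) := by
        rw [← Nat.not_even_iff_odd]
        exact fun h => hmin _ (le_refl _) hlt ⟨le_refl _, h⟩
      obtain ⟨p, hp, h1, h2⟩ := PreRequest.visit_self
        ((r i).shift (G.w (ρ i) (ρ (i + 1)))) hodd ⟨_, hodd, Set.mem_range_self _⟩ rfl
      obtain ⟨q, hq, h3, h4⟩ := (hs i (by omega)).2.1 _ p hp
      refine ⟨_, q, rfl, hq, ?_, ?_⟩ <;> rw [infixWeight_self] <;> omega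
    | succ k hk ih =>
      intro hlt
      obtain ⟨c, p, hc, hp, h1, h2⟩ := ih (by omega)
      have hna := hmin (k + 1) (by omega) hlt
      obtain ⟨q, hq, h3, h4⟩ := (PreRequest.le_visit
        ((r k).shift (G.w (ρ k) (ρ (k + 1)))) (k := G.Ω (ρ (k + 1))) c (by
          rw [hc]
          exact fun h => hna ⟨h.2, h.1⟩)).trans ((hs k (by omega)).2.1 c) _
        (PreRequest.shift_of_eq_some _ hp)
      refine ⟨c, q, hc, hq, ?_, ?_⟩ <;> rw [G.infixWeight_succ ρ (by omega)] <;>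
        simp only [] at h3 h4 <;> omega
  refine cor_le_of (Nat.find_spec hex).1 (Nat.find_spec hex).2 fun k hk hk' => ?_
  rcases Nat.eq_or_lt_of_le hk with rfl | hlt
  · simp [infixWeight_self]
  obtain ⟨k, rfl⟩ : ∃ k', k = k' + 1 := ⟨k - 1, by omega⟩
  obtain ⟨c, p, hc, hp, h1, h2⟩ := claim k (by omega) (by omega)
  have hov := (hs k (by omega)).1
  have hrange : ¬ (p.1 + G.w (ρ k) (ρ (k + 1)) < -(b : ℤ) ∨
      (b : ℤ) < p.2 + G.w (ρ k) (ρ (k + 1))) :=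
    fun h => hov ⟨c, _, PreRequest.shift_of_eq_some _ hp, h⟩
  rw [G.infixWeight_succ ρ (by omega)]
  omega

/-- Some request of color at least `c`, posed at a position in `[s, t]` and not answered before
position `t`, has accumulated weight `x` at position `j`. -/
def HasRequest (ρ : ℕ → V) (s t j c : ℕ) (x : ℤ) : Prop :=
  ∃ i, s ≤ i ∧ i < t ∧ i ≤ j ∧ c ≤ G.Ω (ρ i) ∧ (∀ l, i ≤ l → l < t → ¬ G.Answers ρ i l) ∧
    G.infixWeight ρ i j = x

/-- An answer to a request of color at least `c` is even and at least `c`, so it erases the entry at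
`c`. Requests recorded in surviving entries are therefore still open. -/
theorem hasRequest_visit {ρ : ℕ → V} {s j : ℕ} (hsj : s ≤ j) {r : G.PreRequest}
    (hr : ∀ c p, r c = some p →
      HasRequest (G := G) ρ s j j c p.1 ∧ HasRequest (G := G) ρ s j j c p.2) :
    ∀ c p, r.visit (G.Ω (ρ j)) c = some p →
      HasRequest (G := G) ρ s (j + 1) j c p.1 ∧ HasRequest (G := G) ρ s (j + 1) j c p.2 := by
  have hkeep : ∀ c x, ¬ (Even (G.Ω (ρ j)) ∧ c ≤ G.Ω (ρ j)) → HasRequest (G := G) ρ s j j c x →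
      HasRequest (G := G) ρ s (j + 1) j c x := by
    rintro c x hc ⟨i, h1, h2, h3, h4, h5, h6⟩
    refine ⟨i, h1, by omega, h3, h4, fun l hl hl' hans => ?_, h6⟩
    rcases Nat.lt_or_ge l j with hlt | hge
    · exact h5 l hl hlt hans
    · obtain rfl : l = j := by omega
      exact hc ⟨hans.2, h4.trans hans.1⟩
  intro c p hp
  unfold PreRequest.visit at hp
  split_ifs at hp with h1 h2 h3
  · have := hr c p hp
    exact ⟨hkeep _ _ (fun h => h2 h.2) this.1, hkeep _ _ (fun h => h2 h.2) this.2⟩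
  · have hnew : HasRequest (G := G) ρ s (j + 1) j c 0 := by
      refine ⟨j, hsj, by omega, le_refl _, h3.le, fun l hl hl' hans => ?_, infixWeight_self _ _ _⟩
      obtain rfl : l = j := by omega
      exact h1 hans.2
    cases hc : r c with
    | none =>
      rw [hc] at hp
      obtain rfl := Option.some.inj hp
      exact ⟨hnew, hnew⟩
    | some q =>
      rw [hc] at hp
      obtain rfl := Option.some.inj hp
      have := hr c q hc
      refine ⟨?_, ?_⟩
      · rcases min_choice q.1 0 with h | h
        · simp only [h]
          exact hkeep _ _ (fun h => h1 h.1) this.1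
        · simp only [h]
          exact hnew
      · rcases max_choice q.2 0 with h | h
        · simp only [h]
          exact hkeep _ _ (fun h => h1 h.1) this.2
        · simp only [h]
          exact hnew
  · have := hr c p hp
    exact ⟨hkeep _ _ (fun h => h1 h.1) this.1, hkeep _ _ (fun h => h1 h.1) this.2⟩

theorem HasRequest.shift {ρ : ℕ → V} {s j c : ℕ} {x : ℤ}
    (h : HasRequest (G := G) ρ s (j + 1) j c x) :
    HasRequest (G := G) ρ s (j + 1) (j + 1) c (x + G.w (ρ j) (ρ (j + 1))) := by
  obtain ⟨i, h1, h2, h3, h4, h5, rfl⟩ := h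
  exact ⟨i, h1, h2, by omega, h4, h5, G.infixWeight_succ ρ h3⟩

variable (G b)

/-- The request-function memory structure with states post-processed by `f`. -/
noncomputable def postMemory (f : G.RequestFunction b → G.RequestFunction b) :
    MemoryStructure V (G.RequestFunction b) where
  init v := f ((G.requestMemory b).init v)
  upd r v v' := f ((G.requestMemory b).upd r v v')

/-- A move makes some accumulated weight leave the interval `[-b, b]`. -/
def OverflowAt (q : V × G.RequestFunction b) (v' : V) : Prop :=
  (q.2.1.shift (G.w q.1 v')).Overflow b

open Classical in
/-- The priority of a move: the color of the source, unless some accumulated weight overflows. -/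
noncomputable def priority (B : ℕ) (q : V × G.RequestFunction b) (v' : V) : ℕ :=
  if G.OverflowAt b q v' then 2 * B + 1 else G.Ω q.1

variable {G b}

theorem requestMemory_upd_of_not_overflow {v v' : V} {r : G.RequestFunction b}
    (h : ¬ G.OverflowAt b (v, r) v') :
    ((G.requestMemory b).upd r v v').1 = (r.1.shift (G.w v v')).visit (G.Ω v') :=
  congrArg (fun x : G.PreRequest => x.visit (G.Ω v')) (PreRequest.reset_of_not_overflow h)

theorem priority_le {B : ℕ} (hB : ∀ v, G.Ω v ≤ B) (q : V × G.RequestFunction b) (v' : V) :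
    G.priority b B q v' ≤ 2 * B + 1 := by
  unfold priority
  split_ifs
  · exact le_refl _
  · have := hB q.1
    omega

theorem evenLimsup_priority_iff {B : ℕ} (hB : ∀ v, G.Ω v ≤ B) {ρ : ℕ → V}
    {r : ℕ → G.RequestFunction b} :
    (EvenLimsup fun j => G.priority b B (ρ j, r j) (ρ (j + 1))) ↔
      (∀ᶠ j in atTop, ¬ G.OverflowAt b (ρ j, r j) (ρ (j + 1))) ∧
        EvenLimsup fun j => G.Ω (ρ j) := by
  have hprio : ∀ j, ¬ G.OverflowAt b (ρ j, r j) (ρ (j + 1)) →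
      G.priority b B (ρ j, r j) (ρ (j + 1)) = G.Ω (ρ j) := fun j hj => if_neg hj
  constructor
  · intro h
    have h1 : ∀ᶠ j in atTop, ¬ G.OverflowAt b (ρ j, r j) (ρ (j + 1)) := by
      refine (h (2 * B + 1) ⟨B, rfl⟩ (Eventually.of_forall fun j => priority_le hB _ _)).mono
        fun j hj hov => hj (if_pos hov)
    exact ⟨h1, h.congr (h1.mono hprio)⟩
  · rintro ⟨h1, h2⟩
    exact h2.congr (h1.mono fun j hj => (hprio j hj).symm)

/-- The parity condition on the run of the memory structure guarantees bounded costs. -/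
theorem eventually_cor_le_of_evenLimsup {f : G.RequestFunction b → G.RequestFunction b}
    (hf : ∀ r c, IntervalLe (r.1 c) ((f r).1 c)) {B : ℕ} (hB : ∀ v, G.Ω v ≤ B) {ρ : ℕ → V}
    (h : EvenLimsup fun j =>
      G.priority b B (ρ j, (G.postMemory b f).along ρ j) (ρ (j + 1))) :
    ∀ᶠ i in atTop, G.cor ρ i ≤ b := by
  obtain ⟨h1, h2⟩ := (evenLimsup_priority_iff hB).mp h
  refine eventually_cor_le (fun j => ((G.postMemory b f).along ρ j).1) hB h1 ?_ h2
  filter_upwards [h1] with j hj c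
  rw [MemoryStructure.along_succ]
  rw [← requestMemory_upd_of_not_overflow hj]
  exact hf _ c

/-- Bounded costs guarantee the parity condition on the run of the memory structure. -/
theorem evenLimsup_of_eventually_cor_le {f : G.RequestFunction b → G.RequestFunction b}
    (hf : ∀ r c p, (f r).1 c = some p → ∃ c₁ c₂ p₁ p₂, c ≤ c₁ ∧ c ≤ c₂ ∧ r.1 c₁ = some p₁ ∧
      r.1 c₂ = some p₂ ∧ p.1 = p₁.1 ∧ p.2 = p₂.2) {B : ℕ} (hB : ∀ v, G.Ω v ≤ B) {ρ : ℕ → V}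
    (h : ∀ᶠ i in atTop, G.cor ρ i ≤ b) :
    EvenLimsup fun j =>
      G.priority b B (ρ j, (G.postMemory b f).along ρ j) (ρ (j + 1)) := by
  set r := (G.postMemory b f).along ρ with hr
  refine (evenLimsup_priority_iff hB).mpr ⟨?_, ?_⟩
  · by_contra hfr
    have hfr : ∃ᶠ j in atTop, G.OverflowAt b (ρ j, r j) (ρ (j + 1)) := hfr
    obtain ⟨s, hs⟩ := eventually_atTop.mp h
    obtain ⟨m, hm, hov⟩ := frequently_atTop.mp hfr s
    have hsucc : ∀ j, r (j + 1) = f ((G.requestMemory b).upd (r j) (ρ j) (ρ (j + 1))) :=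
      fun j => (G.postMemory b f).along_succ ρ j
    have hpost : ∀ j, (∀ c p, ((G.requestMemory b).upd (r j) (ρ j) (ρ (j + 1))).1 c = some p →
        HasRequest (G := G) ρ s (j + 1 + 1) (j + 1) c p.1 ∧
        HasRequest (G := G) ρ s (j + 1 + 1) (j + 1) c p.2) →
        ∀ c p, (r (j + 1)).1 c = some p →
        HasRequest (G := G) ρ s (j + 1 + 1) (j + 1) c p.1 ∧
        HasRequest (G := G) ρ s (j + 1 + 1) (j + 1) c p.2 := by
      intro j hj c p hp
      rw [hsucc] at hp
      obtain ⟨c₁, c₂, p₁, p₂, hc₁, hc₂, h1, h2, h3, h4⟩ := hf _ c p hp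
      rw [h3, h4]
      obtain ⟨⟨i, a1, a2, a3, a4, a5⟩, -⟩ := hj c₁ p₁ h1
      obtain ⟨-, ⟨i', b1, b2, b3, b4, b5⟩⟩ := hj c₂ p₂ h2
      have hc₁' : (c : ℕ) ≤ c₁ := hc₁
      have hc₂' : (c : ℕ) ≤ c₂ := hc₂
      exact ⟨⟨i, a1, a2, a3, hc₁'.trans a4, a5⟩, ⟨i', b1, b2, b3, hc₂'.trans b4, b5⟩⟩
    have hshift : ∀ j, (∀ c p, (r j).1 c = some p → HasRequest (G := G) ρ s (j + 1) j c p.1 ∧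
        HasRequest (G := G) ρ s (j + 1) j c p.2) →
        ∀ c p, ((r j).1.shift (G.w (ρ j) (ρ (j + 1)))) c = some p →
        HasRequest (G := G) ρ s (j + 1) (j + 1) c p.1 ∧
        HasRequest (G := G) ρ s (j + 1) (j + 1) c p.2 := by
      intro j hj c p hp
      obtain ⟨q, hq, rfl⟩ := PreRequest.shift_eq_some hp
      exact ⟨(hj c q hq).1.shift, (hj c q hq).2.shift⟩
    -- The overflow at `m` discards everything recorded earlier. From then on each endpoint is the
    -- weight of an open request posed after `s`, so a second overflow would violate the bound on
    -- `cor`.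
    have hinv : ∀ j, m + 1 ≤ j → ∀ c p, (r j).1 c = some p →
        HasRequest (G := G) ρ s (j + 1) j c p.1 ∧ HasRequest (G := G) ρ s (j + 1) j c p.2 := by
      intro j hj
      induction j, hj using Nat.le_induction with
      | base =>
        refine hpost m (hasRequest_visit (by omega) fun c p hp => ?_)
        unfold PreRequest.reset at hp
        split_ifs at hp with hno
        exact absurd hov hno
      | succ j hj ih =>
        refine hpost j (hasRequest_visit (by omega) fun c p hp => ?_)
        unfold PreRequest.reset at hp
        split_ifs at hp
        exact hshift j ih c p hp
    obtain ⟨m', hm', c, p, hp, hout⟩ := frequently_atTop.mp hfr (m + 1)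
    have hcontra : ∀ x : ℤ, HasRequest (G := G) ρ s (m' + 1) (m' + 1) c x →
        b < x.natAbs → False := by
      rintro x ⟨i, h1, h2, h3, h4, h5, rfl⟩ hx
      exact absurd (lt_cor_of h3 h5 hx) (not_lt.mpr (hs i h1))
    obtain ⟨h1, h2⟩ := hshift m' (hinv m' hm') c p hp
    rcases hout with h3 | h3
    · exact hcontra _ h1 (by omega)
    · exact hcontra _ h2 (by omega)
  · intro c hc hle
    by_contra hfr
    have hfr : ∃ᶠ j in atTop, G.Ω (ρ j) = c := by
      simpa [Filter.Frequently] using hfr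
    obtain ⟨s, hs⟩ := eventually_atTop.mp (h.and hle)
    obtain ⟨i, hi, hic⟩ := frequently_atTop.mp hfr s
    obtain ⟨j, hij, h1, h2⟩ := exists_answer_of_cor_le (hs i hi).1
    have h3 := (hs j (by omega)).2
    rw [hic] at h1
    obtain rfl : G.Ω (ρ j) = c := le_antisymm h3 h1
    exact absurd h2 (Nat.not_even_iff_odd.mpr hc)

end ParityGameWithWeights

/-! ### Encoding and counting memory states. -/

namespace MemoryStructure

variable {V M N : Type*}

/-- The memory structure obtained by storing the state `m` at vertex `v` as its code `e v m`. -/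
def encode (𝓜 : MemoryStructure V M) (e : V → M → N) (d : V → N → M) : MemoryStructure V N where
  init v := e v (𝓜.init v)
  upd x v v' := e v' (𝓜.upd (d v x) v v')

/-- The vertex is always known when the memory is read, so the same code may denote different states
at different vertices. -/
theorem updPlus_encode (𝓜 : MemoryStructure V M) {e : V → M → N} {d : V → N → M}
    (hde : ∀ v m, d v (e v m) = m) (w : List V) (v : V) :
    (𝓜.encode e d).updPlus w v = e v (𝓜.updPlus w v) := by
  induction w using List.reverseRecOn generalizing v with
  | nil => rfl
  | append_singleton w u ih =>
    rw [updPlus_append, updPlus_append, ih]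
    simp only [encode, hde]

end MemoryStructure

/-- Unused states pad the memory, so upper bounds on its cardinality suffice. -/
theorem Arena.Strategy.ImplementedBy.hasSize {V M : Type*} {A : Arena V} {i : Fin 2}
    {σ : A.Strategy i} {𝓜 : MemoryStructure V M} (h : σ.ImplementedBy 𝓜) [Finite M] [Nonempty M]
    {s : ℕ} (hs : Nat.card M ≤ s) : σ.HasSize s := by
  let e : M → Fin s := fun m => Fin.castLE hs (Finite.equivFin M m)
  have he : Function.Injective e := (Fin.castLE_injective hs).comp (Finite.equivFin M).injective
  have hde : ∀ m, Function.invFun e (e m) = m := Function.leftInverse_invFun he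
  obtain ⟨Nxt, h1, h2⟩ := h
  refine ⟨Fin s, inferInstance, 𝓜.encode (fun _ => e) (fun _ => Function.invFun e), by simp,
    fun v x => Nxt v (Function.invFun e x), fun v x => h1 v _, fun w v hw => ?_⟩
  rw [h2 w v hw, 𝓜.updPlus_encode (fun _ => hde)]
  exact congrArg (Nxt v) (hde _).symm

/-- The pairs `(l, h)` with `a ≤ l ≤ h < a + n`. -/
noncomputable def subintervals (a : ℤ) (n : ℕ) : Finset (ℤ × ℤ) :=
  (Finset.Ico a (a + n) ×ˢ Finset.Ico a (a + n)).filter fun p => p.1 ≤ p.2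

theorem mem_subintervals {a : ℤ} {n : ℕ} {p : ℤ × ℤ} :
    p ∈ subintervals a n ↔ a ≤ p.1 ∧ p.1 ≤ p.2 ∧ p.2 < a + n := by
  simp only [subintervals, Finset.mem_filter, Finset.mem_product, Finset.mem_Ico]
  omega

theorem two_mul_card_subintervals (a : ℤ) (n : ℕ) :
    2 * (subintervals a n).card = n * (n + 1) := by
  induction n with
  | zero =>
    have : subintervals a 0 = ∅ := by
      ext p
      simp only [mem_subintervals, Finset.notMem_empty, iff_false]
      push_cast
      omega
    simp [this]
  | succ n ih =>
    have h : subintervals a (n + 1) = subintervals a n ∪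
        (Finset.Icc a (a + n)).image fun l => (l, a + (n : ℤ)) := by
      ext ⟨l, h⟩
      simp only [mem_subintervals, Finset.mem_union, Finset.mem_image, Finset.mem_Icc,
        Prod.mk.injEq]
      push_cast
      omega
    have hdisj : Disjoint (subintervals a n)
        ((Finset.Icc a (a + n)).image fun l => (l, a + (n : ℤ))) := by
      rw [Finset.disjoint_left]
      rintro ⟨l, h⟩ h1 h2
      simp only [mem_subintervals, Finset.mem_image, Prod.mk.injEq] at h1 h2
      obtain ⟨l', hl', rfl, rfl⟩ := h2
      omega
    rw [h, Finset.card_union_of_disjoint hdisj,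
      Finset.card_image_of_injective _ (fun x y hxy => (Prod.mk.inj hxy).1), Int.card_Icc, mul_add,
      ih]
    have : (a + n + 1 - a).toNat = n + 1 := by omega
    rw [this]
    ring

/-- The `b`-bounded values of request functions. -/
abbrev BoundedInterval (b : ℕ) : Type :=
  {x : Option (ℤ × ℤ) // ∀ p, x = some p → -(b : ℤ) ≤ p.1 ∧ p.1 ≤ p.2 ∧ p.2 ≤ b}

namespace BoundedInterval

variable {b : ℕ}

theorem mem_insertNone_iff (x : Option (ℤ × ℤ)) :
    x ∈ Finset.insertNone (subintervals (-b) (2 * b + 1)) ↔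
      ∀ p, x = some p → -(b : ℤ) ≤ p.1 ∧ p.1 ≤ p.2 ∧ p.2 ≤ b := by
  rw [Finset.mem_insertNone]
  refine forall_congr' fun p => ?_
  rw [Option.mem_def, mem_subintervals]
  push_cast
  refine imp_congr_right fun _ => ?_
  omega

theorem card : Nat.card (BoundedInterval b) = 2 * b ^ 2 + 3 * b + 2 := by
  rw [Nat.subtype_card _ mem_insertNone_iff, Finset.card_insertNone]
  have := two_mul_card_subintervals (-b) (2 * b + 1)
  have h : (2 * b + 1) * (2 * b + 1 + 1) = 2 * (2 * b ^ 2 + 3 * b + 1) := by ring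
  omega

instance : Finite (BoundedInterval b) :=
  Nat.finite_of_card_ne_zero (by rw [card]; omega)

end BoundedInterval

/-! ### Strategies on the request memory for both players. -/

namespace ParityGameWithWeights

variable {V : Type*} {G : ParityGameWithWeights V} {b : ℕ}

instance [Finite V] : Finite G.OddColors :=
  ((Set.finite_range G.Ω).subset fun _ h => h.2).to_subtype

/-- Bounded request functions are families of bounded values. -/
def requestFunctionEquiv (G : ParityGameWithWeights V) (b : ℕ) :
    G.RequestFunction b ≃ (G.OddColors → BoundedInterval b) :=
  Equiv.subtypePiEquivPi (p := fun _ (x : Option (ℤ × ℤ)) =>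
    ∀ q : ℤ × ℤ, x = some q → -(b : ℤ) ≤ q.1 ∧ q.1 ≤ q.2 ∧ q.2 ≤ b)

instance [Finite V] : Finite (G.RequestFunction b) :=
  Finite.of_equiv _ (G.requestFunctionEquiv b).symm

instance : Nonempty (G.RequestFunction b) := ⟨⟨fun _ => none, by simp⟩⟩

theorem card_requestFunction [Finite V] :
    Nat.card (G.RequestFunction b) = (2 * b ^ 2 + 3 * b + 2) ^ G.numOddColors := by
  rw [Nat.card_congr (G.requestFunctionEquiv b), Nat.card_fun, BoundedInterval.card]
  rfl

theorem exists_color_bound [Finite V] (G : ParityGameWithWeights V) : ∃ B, ∀ v, G.Ω v ≤ B := by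
  obtain ⟨B, hB⟩ := (Set.finite_range G.Ω).bddAbove
  exact ⟨B, fun v => hB (Set.mem_range_self v)⟩

theorem requestMemory_eq_postMemory : G.requestMemory b = G.postMemory b id := rfl

theorem cost₀_le_iff {v : V} {σ : G.Strategy 0} :
    G.cost₀ v σ ≤ b ↔ ∀ ρ, G.IsPlay ρ → ρ 0 = v → σ.Consistent ρ →
      ∀ᶠ i in atTop, G.cor ρ i ≤ b := by
  unfold cost₀
  rw [iSup₂_le_iff]
  constructor
  · exact fun h ρ h1 h2 h3 => (limsup_cor_le_iff ρ).mp (h ρ ⟨h1, h2, h3⟩)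
  · exact fun h ρ hρ => (limsup_cor_le_iff ρ).mpr (h ρ hρ.1 hρ.2.1 hρ.2.2)

theorem succ_le_cost₁_iff {v : V} {τ : G.Strategy 1} :
    ((b + 1 : ℕ) : ℕ∞) ≤ G.cost₁ v τ ↔ ∀ ρ, G.IsPlay ρ → ρ 0 = v → τ.Consistent ρ →
      ¬ ∀ᶠ i in atTop, G.cor ρ i ≤ b := by
  have hlt : ∀ x : ℕ∞, ((b + 1 : ℕ) : ℕ∞) ≤ x ↔ ¬ x ≤ b := by
    intro x
    rw [not_le, ← ENat.add_one_le_iff (ENat.natCast_ne_top b)]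
    push_cast
    rfl
  unfold cost₁
  rw [le_iInf₂_iff]
  constructor
  · intro h ρ h1 h2 h3
    rw [← limsup_cor_le_iff, ← hlt]
    exact h ρ ⟨h1, h2, h3⟩
  · intro h ρ hρ
    rw [hlt, limsup_cor_le_iff]
    exact h ρ hρ.1 hρ.2.1 hρ.2.2

theorem exists_requestMemory_strategy [Finite V] {v : V} {σ : G.Strategy 0}
    (hσ : G.cost₀ v σ ≤ b) :
    ∃ σ' : G.Strategy 0, G.cost₀ v σ' ≤ b ∧ σ'.ImplementedBy (G.requestMemory b) := by
  obtain ⟨B, hB⟩ := G.exists_color_bound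
  rw [cost₀_le_iff] at hσ
  obtain ⟨Nxt, W, hE, h0, hW, hgood⟩ := Arena.exists_positional_in_product σ (G.requestMemory b)
    (G.priority b B) (priority_le hB) v (fun ρ h1 h2 h3 => by
      rw [requestMemory_eq_postMemory]
      exact evenLimsup_of_eventually_cor_le (fun r c p hp =>
        ⟨c, c, p, p, le_refl _, le_refl _, hp, hp, rfl, rfl⟩) hB (hσ ρ h1 h2 h3))
  refine ⟨.ofMemory _ Nxt hE, cost₀_le_iff.mpr fun ρ h1 h2 h3 => ?_,
    Arena.Strategy.ofMemory_implementedBy _ _ _⟩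
  have hWj : ∀ j, (ρ j, (G.requestMemory b).along ρ j) ∈ W := by
    intro j
    induction j with
    | zero => rw [MemoryStructure.along_zero, h2]; exact h0
    | succ j ih => rw [MemoryStructure.along_succ]; exact hW _ _ _ ih (h3.allowed h1 j)
  exact eventually_cor_le_of_evenLimsup (f := id) (fun _ _ => .refl _) hB
    (hgood ρ _ hWj (h3.allowed h1) (MemoryStructure.along_succ _ ρ))

theorem exists_finiteState_strategy₁ [Finite V] {v : V} {τ : G.Strategy 1}
    (hτ : ((b + 1 : ℕ) : ℕ∞) ≤ G.cost₁ v τ) :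
    ∃ τ' : G.Strategy 1, ((b + 1 : ℕ) : ℕ∞) ≤ G.cost₁ v τ' ∧
      τ'.ImplementedBy (G.requestMemory b) := by
  obtain ⟨B, hB⟩ := G.exists_color_bound
  rw [succ_le_cost₁_iff] at hτ
  obtain ⟨Nxt, W, hE, h0, hW, hgood⟩ := Arena.exists_positional_in_product τ (G.requestMemory b)
    (fun q v' => G.priority b B q v' + 1) (fun q v' => Nat.succ_le_succ (priority_le hB q v')) v
    (fun ρ h1 h2 h3 => EvenLimsup.succ_of_not fun h => hτ ρ h1 h2 h3 <|
      eventually_cor_le_of_evenLimsup (f := id) (fun _ _ => .refl _) hB h)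
  refine ⟨.ofMemory _ Nxt hE, succ_le_cost₁_iff.mpr fun ρ h1 h2 h3 hcor => ?_,
    Arena.Strategy.ofMemory_implementedBy _ _ _⟩
  have hWj : ∀ j, (ρ j, (G.requestMemory b).along ρ j) ∈ W := by
    intro j
    induction j with
    | zero => rw [MemoryStructure.along_zero, h2]; exact h0
    | succ j ih => rw [MemoryStructure.along_succ]; exact hW _ _ _ ih (h3.allowed h1 j)
  refine EvenLimsup.not_of_succ (fun j => priority_le hB _ _)
    (hgood ρ _ hWj (h3.allowed h1) (MemoryStructure.along_succ _ ρ)) ?_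
  rw [requestMemory_eq_postMemory]
  exact evenLimsup_of_eventually_cor_le (fun r c p hp =>
    ⟨c, c, p, p, le_refl _, le_refl _, hp, hp, rfl, rfl⟩) hB hcor

/-- For a positive target, request functions with bound one smaller suffice; a target of `0` is met
by any strategy. The stated size leaves room, including the factor `Nat.card V`. -/
theorem exists_player₁_strategy [Finite V] {v : V} {τ : G.Strategy 1}
    (hτ : (b : ℕ∞) ≤ G.cost₁ v τ) :
    ∃ τ' : G.Strategy 1, (b : ℕ∞) ≤ G.cost₁ v τ' ∧
      τ'.HasSize (Nat.card V * (2 * b ^ 2 + 3 * b + 2) ^ G.numOddColors) := by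
  have : Nonempty V := ⟨v⟩
  have hV : 1 ≤ Nat.card V := Nat.card_pos
  cases b with
  | zero =>
    obtain ⟨τ', -, hτ'⟩ : ∃ τ' : G.Strategy 1, True ∧
        τ'.ImplementedBy (⟨fun _ => (), fun _ _ _ => ()⟩ : MemoryStructure V Unit) :=
      ⟨.ofMemory _ (fun v _ => (G.nonterminal v).choose)
        (fun v _ => (G.nonterminal v).choose_spec), trivial,
        Arena.Strategy.ofMemory_implementedBy _ _ _⟩
    refine ⟨τ', by simp, hτ'.hasSize ?_⟩
    rw [Nat.card_unique]
    exact Nat.mul_pos hV (by positivity)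
  | succ b =>
    obtain ⟨τ', h1, h2⟩ := exists_finiteState_strategy₁ hτ
    refine ⟨τ', h1, h2.hasSize ?_⟩
    rw [card_requestFunction]
    refine le_trans (Nat.pow_le_pow_left ?_ _) (Nat.le_mul_of_pos_left _ hV)
    nlinarith

end ParityGameWithWeights

/-! ### Counting decreasing tuples of intervals. -/

/-- Sequences that are decreasing with respect to `le`. -/
abbrev DecreasingTuple {P : Type*} (le : P → P → Prop) (m : ℕ) : Type _ :=
  {f : Fin m → P // ∀ i j, i < j → le (f j) (f i)}

/-- Split by the first entry: if it is `top`, a shorter tuple remains; otherwise each later entry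
lies among the at most `k` elements below it. -/
theorem card_decreasingTuple_succ_le {P : Type*} [Finite P] (le : P → P → Prop) (top : P) {k : ℕ}
    (hk : ∀ x, x ≠ top → Nat.card {y // le y x} ≤ k) (m : ℕ) :
    Nat.card (DecreasingTuple le (m + 1)) ≤
      Nat.card (DecreasingTuple le m) + (Nat.card P - 1) * k ^ m := by
  classical
  have := Fintype.ofFinite P
  let F : DecreasingTuple le (m + 1) →
      DecreasingTuple le m ⊕ Σ x : {x : P // x ≠ top}, Fin m → {y // le y x.1} := fun f =>
    if h : f.1 0 = top then
      Sum.inl ⟨fun i => f.1 i.succ, fun i j hij => f.2 _ _ (Fin.succ_lt_succ_iff.mpr hij)⟩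
    else Sum.inr ⟨⟨f.1 0, h⟩, fun i => ⟨f.1 i.succ, f.2 _ _ (Fin.succ_pos i)⟩⟩
  have hF : Function.Injective F := by
    intro f g hfg
    have key : f.1 0 = g.1 0 ∧ ∀ i : Fin m, f.1 i.succ = g.1 i.succ := by
      by_cases hf : f.1 0 = top <;> by_cases hg : g.1 0 = top
      · simp only [F, dif_pos hf, dif_pos hg, Sum.inl.injEq, Subtype.mk.injEq] at hfg
        exact ⟨hf.trans hg.symm, congrFun hfg⟩
      · simp [F, dif_pos hf, dif_neg hg] at hfg
      · simp [F, dif_neg hf, dif_pos hg] at hfg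
      · simp only [F, dif_neg hf, dif_neg hg, Sum.inr.injEq] at hfg
        have h0 : f.1 0 = g.1 0 := congrArg (fun x => x.1.1) hfg
        exact ⟨h0, fun i => congrArg
          (fun x : Σ x : {x : P // x ≠ top}, Fin m → {y // le y x.1} => (x.2 i).1) hfg⟩
    exact Subtype.ext (funext (Fin.cases key.1 key.2))
  refine (Nat.card_le_card_of_injective F hF).trans ?_
  rw [Nat.card_sum, Nat.card_sigma]
  refine Nat.add_le_add_left ?_ _
  have hcard : Nat.card P - 1 = Fintype.card {x : P // x ≠ top} := by
    rw [Nat.card_eq_fintype_card, Fintype.card_subtype_compl, Fintype.card_subtype_eq]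
  rw [hcard, ← smul_eq_mul, ← Finset.card_univ]
  refine Finset.sum_le_card_nsmul _ _ _ fun x _ => ?_
  rw [Nat.card_fun, Nat.card_fin]
  exact Nat.pow_le_pow_left (hk x.1 x.2) m

namespace BoundedInterval

variable {b : ℕ}

theorem card_le_of_ne_top (x : BoundedInterval b)
    (hx : x.1 ≠ some (-(b : ℤ), (b : ℤ))) :
    Nat.card {y : BoundedInterval b // IntervalLe y.1 x.1} ≤ 2 * b ^ 2 + b + 1 := by
  -- A proper subinterval of `[-b, b]` misses an end, hence lies among `2 * b` consecutive integers.
  -- These have `2 * b ^ 2 + b` subintervals, plus the empty one.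
  obtain ⟨a, ha⟩ : ∃ a : ℤ, ∀ p, x.1 = some p → a ≤ p.1 ∧ p.2 < a + (2 * b : ℕ) := by
    rcases hx' : x.1 with _ | p
    · exact ⟨0, by simp⟩
    · have hb := x.2 p hx'
      by_cases h : p.1 = -b
      · refine ⟨-b, fun q hq => ?_⟩
        obtain rfl := Option.some.inj hq
        have : p.2 ≠ b := fun h' => hx (by rw [hx', ← h, ← h'])
        push_cast
        omega
      · refine ⟨-b + 1, fun q hq => ?_⟩
        obtain rfl := Option.some.inj hq
        push_cast
        omega
  have hinj : Function.Injective
      (fun y : {y : BoundedInterval b // IntervalLe y.1 x.1} => (⟨y.1.1, by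
        rw [Finset.mem_insertNone]
        intro p hp
        obtain ⟨q, hq, h1, h2⟩ := y.2 p hp
        have := ha q hq
        have := y.1.2 p hp
        rw [mem_subintervals]
        omega⟩ : {z // z ∈ Finset.insertNone (subintervals a (2 * b))})) :=
    fun y z hyz => Subtype.ext (Subtype.ext (Subtype.mk.inj hyz))
  refine (Nat.card_le_card_of_injective _ hinj).trans ?_
  rw [Nat.card_eq_fintype_card, Fintype.card_coe, Finset.card_insertNone]
  have := two_mul_card_subintervals a (2 * b)
  have h : 2 * b * (2 * b + 1) = 2 * (2 * b ^ 2 + b) := by ring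
  omega

theorem mul_card_decreasingTuple_le (m : ℕ) :
    (2 * b + 1) * Nat.card (DecreasingTuple (P := BoundedInterval b)
      (fun x y => IntervalLe x.1 y.1) m) ≤ (2 * b ^ 2 + b + 2) ^ (m + 1) := by
  induction m with
  | zero =>
    rw [Nat.card_eq_one_iff_unique.mpr ⟨⟨fun f g => Subtype.ext (Subsingleton.elim _ _)⟩,
      ⟨⟨Fin.elim0, fun i => i.elim0⟩⟩⟩]
    have := Nat.le_self_pow two_ne_zero b
    rw [zero_add, pow_one]
    omega
  | succ m ih =>
    have h := card_decreasingTuple_succ_le (P := BoundedInterval b)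
      (fun x y => IntervalLe x.1 y.1)
      ⟨some (-b, b), fun p hp => by obtain rfl := Option.some.inj hp; simp only []; omega⟩
      (fun x hx => card_le_of_ne_top x fun h => hx (Subtype.ext h)) m
    rw [card] at h
    -- This inequality is what the induction step requires of the base `2 * b ^ 2 + b + 2`.
    have h1 : (2 * b + 1) * (2 * b ^ 2 + 3 * b + 2 - 1) ≤
        (2 * b ^ 2 + b + 2) * (2 * b ^ 2 + b + 1) := by
      have : 2 * b ^ 2 + 3 * b + 2 - 1 = 2 * b ^ 2 + 3 * b + 1 := by omega
      rw [this]
      rcases Nat.lt_or_ge b 2 with hb | hb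
      · interval_cases b <;> norm_num
      · obtain ⟨c, rfl⟩ := Nat.exists_eq_add_of_le hb
        ring_nf
        nlinarith [Nat.zero_le c]
    have h2 : (2 * b ^ 2 + b + 1) ^ m ≤ (2 * b ^ 2 + b + 2) ^ m :=
      Nat.pow_le_pow_left (by omega) m
    calc _ ≤ (2 * b + 1) * (_ + (2 * b ^ 2 + 3 * b + 2 - 1) * (2 * b ^ 2 + b + 1) ^ m) :=
          Nat.mul_le_mul_left _ h
      _ ≤ (2 * b ^ 2 + b + 2) ^ (m + 1) +
          (2 * b ^ 2 + b + 2) * (2 * b ^ 2 + b + 1) * (2 * b ^ 2 + b + 2) ^ m := by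
          rw [mul_add, ← mul_assoc]
          exact Nat.add_le_add ih (Nat.mul_le_mul h1 h2)
      _ = _ := by ring

end BoundedInterval

/-! ### Nested request functions and prolonging the top interval. -/

/-- The number of points of an interval. -/
def intervalSize : Option (ℤ × ℤ) → ℕ
  | none => 0
  | some p => (p.2 - p.1).toNat + 1

/-- The left endpoint of an interval in `[-b, b]`. -/
def leftEnd (b : ℕ) : Option (ℤ × ℤ) → ℤ
  | none => -b
  | some p => p.1

theorem IntervalLe.size_le {x y : Option (ℤ × ℤ)} (h : IntervalLe x y) :
    intervalSize x ≤ intervalSize y := by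
  cases x with
  | none => exact Nat.zero_le _
  | some p =>
    obtain ⟨q, rfl, h1, h2⟩ := h p rfl
    simp only [intervalSize]
    omega

theorem IntervalLe.eq_of_size_le {x y : Option (ℤ × ℤ)} (h : IntervalLe x y)
    (hx : ∀ p, x = some p → p.1 ≤ p.2) (hs : intervalSize y ≤ intervalSize x) : x = y := by
  cases x with
  | none =>
    cases y with
    | none => rfl
    | some q => simp [intervalSize] at hs
  | some p =>
    obtain ⟨q, rfl, h1, h2⟩ := h p rfl
    have := hx p rfl
    simp only [intervalSize] at hs
    rw [Option.some.injEq, Prod.ext_iff]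
    omega

/-- Giving the empty interval the left end `-b` costs no additional value: it is contained in every
interval anyway. -/
theorem intervalLe_total_of_leftEnd_eq {b : ℕ} {x y : Option (ℤ × ℤ)}
    (h : leftEnd b x = leftEnd b y) : IntervalLe x y ∨ IntervalLe y x := by
  cases x with
  | none => exact Or.inl fun p hp => absurd hp (by simp)
  | some p =>
    cases y with
    | none => exact Or.inr fun p hp => absurd hp (by simp)
    | some q =>
      have h' : p.1 = q.1 := h
      rcases le_total p.2 q.2 with h2 | h2
      · exact Or.inl fun p' hp' => ⟨q, rfl, by obtain rfl := Option.some.inj hp'; omega⟩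
      · exact Or.inr fun p' hp' => ⟨p, rfl, by obtain rfl := Option.some.inj hp'; omega⟩

namespace ParityGameWithWeights

variable {V : Type u} {G : ParityGameWithWeights V} {b : ℕ}

/-- The interval of a color contains the intervals of all larger colors. -/
def Nested (r : G.RequestFunction b) : Prop :=
  ∀ c c', c ≤ c' → IntervalLe (r.1 c') (r.1 c)

/-- Take the hull of the intervals of all colors at least `c`. Its endpoints are attained, so they
are still recorded weights of requests of color at least `c`. -/
theorem exists_nest [Finite V] (r : G.RequestFunction b) : ∃ r' : G.RequestFunction b,
    (∀ c, IntervalLe (r.1 c) (r'.1 c)) ∧ Nested r' ∧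
    (∀ c p, r'.1 c = some p → ∃ c₁ c₂ p₁ p₂, c ≤ c₁ ∧ c ≤ c₂ ∧ r.1 c₁ = some p₁ ∧
      r.1 c₂ = some p₂ ∧ p.1 = p₁.1 ∧ p.2 = p₂.2) := by
  have hex : ∀ c, ∃ x, (∀ c', c ≤ c' → IntervalLe (r.1 c') x) ∧
      ∀ p, x = some p → ∃ c₁ c₂ p₁ p₂, c ≤ c₁ ∧ c ≤ c₂ ∧ r.1 c₁ = some p₁ ∧
        r.1 c₂ = some p₂ ∧ p.1 = p₁.1 ∧ p.2 = p₂.2 := by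
    intro c
    let S : Set (ℤ × ℤ) := {p | ∃ c', c ≤ c' ∧ r.1 c' = some p}
    have hfin : S.Finite := (Set.finite_range fun c' => (r.1 c').getD 0).subset (by
      rintro p ⟨c', -, hp⟩
      exact ⟨c', by simp [hp]⟩)
    by_cases hne : S.Nonempty
    · obtain ⟨p₁, ⟨c₁, hc₁, hp₁⟩, hmin⟩ := Set.exists_min_image S Prod.fst hfin hne
      obtain ⟨p₂, ⟨c₂, hc₂, hp₂⟩, hmax⟩ := Set.exists_max_image S Prod.snd hfin hne
      refine ⟨some (p₁.1, p₂.2), fun c' hc' p hp => ⟨_, rfl, hmin p ⟨c', hc', hp⟩,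
        hmax p ⟨c', hc', hp⟩⟩, fun p hp => ?_⟩
      obtain rfl := Option.some.inj hp
      exact ⟨c₁, c₂, p₁, p₂, hc₁, hc₂, hp₁, hp₂, rfl, rfl⟩
    · exact ⟨none, fun c' hc' p hp => absurd ⟨p, c', hc', hp⟩ hne, by simp⟩
  choose x hx1 hx2 using hex
  refine ⟨⟨x, fun c p hp => ?_⟩, fun c => hx1 c c (le_refl _), fun c c' hcc' p hp => ?_, hx2⟩
  · obtain ⟨c₁, c₂, p₁, p₂, hc₁, hc₂, hp₁, hp₂, h1, h2⟩ := hx2 c p hp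
    obtain ⟨q, hq, h3, h4⟩ := hx1 c c₁ hc₁ p₁ hp₁
    rw [hp] at hq
    obtain rfl := Option.some.inj hq
    have := r.2 c₁ p₁ hp₁
    have := r.2 c₂ p₂ hp₂
    omega
  · obtain ⟨c₁, c₂, p₁, p₂, hc₁, hc₂, hp₁, hp₂, h1, h2⟩ := hx2 c' p hp
    obtain ⟨q, hq, h3, h4⟩ := hx1 c c₁ (hcc'.trans hc₁) p₁ hp₁
    obtain ⟨q', hq', h3', h4'⟩ := hx1 c c₂ (hcc'.trans hc₂) p₂ hp₂
    rw [hq] at hq'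
    obtain rfl := Option.some.inj hq'
    exact ⟨q, hq, by omega, by omega⟩

/-- The smallest nested request function that contains a given one. -/
noncomputable def nest [Finite V] (r : G.RequestFunction b) : G.RequestFunction b :=
  (exists_nest r).choose

theorem le_nest [Finite V] (r : G.RequestFunction b) (c : G.OddColors) :
    IntervalLe (r.1 c) ((nest r).1 c) := (exists_nest r).choose_spec.1 c

theorem nested_nest [Finite V] (r : G.RequestFunction b) : Nested (nest r) :=
  (exists_nest r).choose_spec.2.1

theorem nest_eq_some [Finite V] (r : G.RequestFunction b) : ∀ c p, (nest r).1 c = some p →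
    ∃ c₁ c₂ p₁ p₂, c ≤ c₁ ∧ c ≤ c₂ ∧ r.1 c₁ = some p₁ ∧
      r.1 c₂ = some p₂ ∧ p.1 = p₁.1 ∧ p.2 = p₂.2 := (exists_nest r).choose_spec.2.2

/-- `r'` arises from `r` by moving the right endpoint of the interval of the color `c₀` to the
right; the empty interval may be replaced by one starting in `-b`. -/
def Extends (c₀ : G.OddColors) (r r' : G.RequestFunction b) : Prop :=
  (∀ c, c ≠ c₀ → r'.1 c = r.1 c) ∧ IntervalLe (r.1 c₀) (r'.1 c₀) ∧
    leftEnd b (r'.1 c₀) = leftEnd b (r.1 c₀)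

theorem Extends.intervalLe {c₀ : G.OddColors} {r r' : G.RequestFunction b}
    (h : Extends c₀ r r') (c : G.OddColors) : IntervalLe (r.1 c) (r'.1 c) := by
  by_cases hc : c = c₀
  · rw [hc]
    exact h.2.1
  · rw [h.1 c hc]
    exact .refl _

theorem Extends.eq_of_size_le {c₀ : G.OddColors} {r r' : G.RequestFunction b}
    (h : Extends c₀ r r') (hs : intervalSize (r'.1 c₀) ≤ intervalSize (r.1 c₀)) : r = r' := by
  refine Subtype.ext (funext fun c => ?_)
  by_cases hc : c = c₀
  · rw [hc]
    exact h.2.1.eq_of_size_le (fun p hp => (r.2 c₀ p hp).2.1) hs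
  · exact (h.1 c hc).symm

/-- The members of `S` that cannot be extended properly within `S`. -/
def maximalIn (c₀ : G.OddColors) (S : Set (G.RequestFunction b)) : Set (G.RequestFunction b) :=
  {r ∈ S | ∀ r' ∈ S, Extends c₀ r r' → intervalSize (r'.1 c₀) ≤ intervalSize (r.1 c₀)}

theorem exists_extends_maximalIn [Finite V] (c₀ : G.OddColors) {S : Set (G.RequestFunction b)}
    {r : G.RequestFunction b} (hr : r ∈ S) : ∃ r' ∈ maximalIn c₀ S, Extends c₀ r r' := by
  obtain ⟨r', ⟨h1, h2⟩, hmax⟩ := Set.exists_max_image {r' | r' ∈ S ∧ Extends c₀ r r'}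
    (fun r' => intervalSize (r'.1 c₀)) (Set.toFinite _) ⟨r, hr, fun _ _ => rfl, .refl _, rfl⟩
  refine ⟨r', ⟨h1, fun r'' h3 h4 => hmax r'' ⟨h3, fun c hc => ?_, ?_, ?_⟩⟩, h2⟩
  · rw [h4.1 c hc, h2.1 c hc]
  · exact h2.2.1.trans h4.2.1
  · rw [h4.2.2, h2.2.2]

/-- Two members agreeing off the top color and in the left end of its interval extend one another in
some direction, so maximality makes them equal. This leaves `2 * b + 1` left ends times the
decreasing tuples of the other colors. -/
theorem card_maximalIn_le [Finite V] {m : ℕ} (e : Fin (m + 1) ≃o G.OddColors)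
    {S : Set (G.RequestFunction b)} (hS : ∀ r ∈ S, Nested r) :
    Nat.card (maximalIn (e (Fin.last m)) S) ≤ (2 * b ^ 2 + b + 2) ^ (m + 1) := by
  have hleft : ∀ r : G.RequestFunction b,
      leftEnd b (r.1 (e (Fin.last m))) ∈ Finset.Icc (-(b : ℤ)) b := by
    intro r
    rw [Finset.mem_Icc]
    cases h : r.1 (e (Fin.last m)) with
    | none => simp only [leftEnd]; omega
    | some p =>
      have := r.2 _ p h
      simp only [leftEnd]
      omega
  let F : maximalIn (e (Fin.last m)) S → Finset.Icc (-(b : ℤ)) b ×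
      DecreasingTuple (P := BoundedInterval b) (fun x y => IntervalLe x.1 y.1) m := fun r =>
    (⟨_, hleft r.1⟩, ⟨fun i => ⟨r.1.1 (e i.castSucc), r.1.2 _⟩, fun i j hij =>
      hS r.1 r.2.1 _ _ (e.monotone (Fin.castSucc_le_castSucc_iff.mpr hij.le))⟩)
  have hF : Function.Injective F := by
    have key : ∀ r r' : maximalIn (e (Fin.last m)) S, F r = F r' →
        IntervalLe (r.1.1 (e (Fin.last m))) (r'.1.1 (e (Fin.last m))) → r = r' := by
      intro r r' hrr' hle
      have hext : Extends (e (Fin.last m)) r.1 r'.1 := by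
        refine ⟨fun c hc => ?_, hle, ?_⟩
        · obtain ⟨i, rfl⟩ := e.surjective c
          obtain ⟨i, rfl⟩ := Fin.exists_castSucc_eq.mpr fun h => hc (congrArg e h)
          exact (congrArg (fun x => (x.2.1 i).1) hrr').symm
        · exact (congrArg (fun x => (x.1 : ℤ)) hrr').symm
      exact Subtype.ext (hext.eq_of_size_le (r.2.2 r'.1 r'.2.1 hext))
    intro r r' hrr'
    rcases intervalLe_total_of_leftEnd_eq (b := b) (congrArg (fun x => (x.1 : ℤ)) hrr') with h | h
    · exact key r r' hrr' h
    · exact (key r' r hrr'.symm h).symm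
  refine (Nat.card_le_card_of_injective F hF).trans ?_
  rw [Nat.card_prod, Nat.card_eq_fintype_card (α := Finset.Icc (-(b : ℤ)) b), Fintype.card_coe,
    Int.card_Icc]
  have : ((b : ℤ) + 1 - -b).toNat = 2 * b + 1 := by omega
  rw [this]
  exact BoundedInterval.mul_card_decreasingTuple_le m

/-- A color is not answered by a visit to a vertex of another color, so its interval does not
shrink. -/
theorem intervalSize_le_of_not_answered {r : G.PreRequest} (x : ℤ) {k : ℕ} (c : G.OddColors)
    (hk : ¬ (Even k ∧ (c : ℕ) ≤ k)) :
    intervalSize (r c) ≤ intervalSize ((r.shift x).visit k c) := by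
  refine le_trans (le_of_eq ?_) (PreRequest.le_visit (r.shift x) c hk).size_le
  cases h : r c with
  | none => simp [PreRequest.shift, h]
  | some p => simp [PreRequest.shift_of_eq_some x h, intervalSize]

theorem intervalSize_le (r : G.RequestFunction b) (c : G.OddColors) :
    intervalSize (r.1 c) ≤ 2 * b + 1 := by
  cases h : r.1 c with
  | none => exact Nat.zero_le _
  | some p =>
    have := r.2 c p h
    simp only [intervalSize]
    omega

/-! ### The compressed strategy for Player 0. -/

theorem exists_compressed_strategy [Finite V] {v : V} {σ : G.Strategy 0} (hσ : G.cost₀ v σ ≤ b)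
    {m : ℕ} (hm : G.numOddColors = m + 1) :
    ∃ σ' : G.Strategy 0, G.cost₀ v σ' ≤ b ∧ σ'.HasSize ((2 * b ^ 2 + b + 2) ^ (m + 1)) := by
  classical
  obtain ⟨B, hB⟩ := G.exists_color_bound
  rw [cost₀_le_iff] at hσ
  have := Fintype.ofFinite G.OddColors
  let e : Fin (m + 1) ≃o G.OddColors := Fintype.orderIsoFinOfCardEq _ (by
    rw [← Nat.card_eq_fintype_card]
    exact hm)
  set top := e (Fin.last m)
  have hle_top : ∀ c : G.OddColors, c ≤ top := fun c => by
    rw [← e.apply_symm_apply c]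
    exact e.monotone (Fin.le_last _)
  set 𝓝 := G.postMemory b nest
  obtain ⟨Nxt, W, hE, h0, hW, hgood⟩ := Arena.exists_positional_in_product σ 𝓝
    (G.priority b B) (priority_le hB) v (fun ρ h1 h2 h3 =>
      evenLimsup_of_eventually_cor_le nest_eq_some hB (hσ ρ h1 h2 h3))
  let W' : Set (V × G.RequestFunction b) := {q | q ∈ W ∧ Nested q.2}
  have h0' : (v, 𝓝.init v) ∈ W' := ⟨h0, nested_nest _⟩
  have hW' : ∀ v r v', (v, r) ∈ W' → G.Allowed Nxt v r v' → (v', 𝓝.upd r v v') ∈ W' :=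
    fun v r v' hr hal => ⟨hW v r v' hr.1 hal, nested_nest _⟩
  -- This rank handles overflows only; the parity of the colors is recovered at the end from the
  -- eventual run.
  obtain ⟨θ, hθle, hθlt⟩ := exists_rank
    (fun q q' : V × G.RequestFunction b => q ∈ W' ∧ G.Allowed Nxt q.1 q.2 q'.1 ∧
      q'.2 = 𝓝.upd q.2 q.1 q'.1)
    (fun q q' => G.OverflowAt b q q'.1) (fun f hf =>
      ((evenLimsup_priority_iff hB).mp (hgood (fun n => (f n).1) (fun n => (f n).2)
        (fun n => (hf n).1.1) (fun n => (hf n).2.1) (fun n => (hf n).2.2))).1)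
  let S : V → Set (G.RequestFunction b) := fun u =>
    {r | (u, r) ∈ W' ∧ ∀ r', (u, r') ∈ W' → θ (u, r) ≤ θ (u, r')}
  -- A state already of minimal rank is merely extended at the top color; any other state may be
  -- replaced by an unrelated one, because this strictly lowers the rank and so happens only
  -- finitely often.
  have hnorm : ∀ (u : V) (r : G.RequestFunction b), ∃ r', (u, r) ∈ W' →
      r' ∈ maximalIn top (S u) ∧ (r ∈ S u → Extends top r r') := by
    intro u r
    by_cases hr : (u, r) ∈ W'
    · by_cases hrS : r ∈ S u
      · obtain ⟨r', h1, h2⟩ := exists_extends_maximalIn top hrS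
        exact ⟨r', fun _ => ⟨h1, fun _ => h2⟩⟩
      · obtain ⟨_, ⟨r₁, hr₁, rfl⟩, hmin⟩ := WellFounded.has_min (wellFounded_lt (α := Ordinal))
          ((fun r' => θ (u, r')) '' {r' | (u, r') ∈ W'}) ⟨_, r, hr, rfl⟩
        obtain ⟨r', h1, -⟩ := exists_extends_maximalIn top (S := S u) (r := r₁)
          ⟨hr₁, fun r' hr' => not_lt.mp (hmin _ ⟨r', hr', rfl⟩)⟩
        exact ⟨r', fun _ => ⟨h1, fun h => absurd h hrS⟩⟩
    · exact ⟨r, fun h => absurd h hr⟩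
  choose norm hnorm using hnorm
  have hcode : ∀ u : V, ∃ (enc : G.RequestFunction b → Fin ((2 * b ^ 2 + b + 2) ^ (m + 1)))
      (dec : Fin ((2 * b ^ 2 + b + 2) ^ (m + 1)) → G.RequestFunction b),
      ∀ r ∈ maximalIn top (S u), dec (enc r) = r := by
    intro u
    have hcard := card_maximalIn_le e (S := S u) fun r hr => hr.1.2
    let ι : maximalIn top (S u) → Fin ((2 * b ^ 2 + b + 2) ^ (m + 1)) :=
      fun r => Fin.castLE hcard (Finite.equivFin _ r)
    have hι : Function.Injective ι :=
      (Fin.castLE_injective hcard).comp (Finite.equivFin _).injective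
    let enc : G.RequestFunction b → Fin ((2 * b ^ 2 + b + 2) ^ (m + 1)) := fun r =>
      if hr : r ∈ maximalIn top (S u) then ι ⟨r, hr⟩ else ⟨0, by positivity⟩
    have henc : Set.InjOn enc (maximalIn top (S u)) := by
      intro r hr r' hr' heq
      simp only [enc, dif_pos hr, dif_pos hr'] at heq
      exact congrArg Subtype.val (hι heq)
    exact ⟨enc, Function.invFunOn enc (maximalIn top (S u)), fun r hr =>
      henc.leftInvOn_invFunOn hr⟩
  choose enc dec hcode using hcode
  let 𝓜 : MemoryStructure V (Fin ((2 * b ^ 2 + b + 2) ^ (m + 1))) :=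
    MemoryStructure.encode ⟨fun u => norm u (𝓝.init u),
      fun r u u' => norm u' (𝓝.upd r u u')⟩ enc dec
  refine ⟨.ofMemory 𝓜 (fun u x => Nxt u (dec u x)) (fun u x => hE u _), ?_,
    _, inferInstance, 𝓜, by simp, Arena.Strategy.ofMemory_implementedBy _ _ _⟩
  refine cost₀_le_iff.mpr fun ρ h1 h2 h3 => ?_
  set r : ℕ → G.RequestFunction b := fun j => dec (ρ j) (𝓜.along ρ j) with hr
  have hal : ∀ j, G.Allowed Nxt (ρ j) (r j) (ρ (j + 1)) := h3.allowed h1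
  have hr0 : r 0 = norm v (𝓝.init v) := by
    simp only [hr, 𝓜.along_zero, h2]
    exact hcode _ _ (hnorm _ _ h0').1
  have hrsucc' : ∀ j, r (j + 1) =
      dec (ρ (j + 1)) (enc (ρ (j + 1)) (norm (ρ (j + 1)) (𝓝.upd (r j) (ρ j) (ρ (j + 1))))) := by
    intro j
    simp only [hr, 𝓜.along_succ]
    rfl
  have hmax : ∀ j, r j ∈ maximalIn top (S (ρ j)) := by
    intro j
    induction j with
    | zero =>
      rw [hr0, h2]
      exact (hnorm _ _ h0').1
    | succ j ih =>
      have := (hnorm _ _ (hW' _ _ _ ih.1.1 (hal j))).1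
      rw [hrsucc', hcode _ _ this]
      exact this
  have hupd : ∀ j, (ρ (j + 1), 𝓝.upd (r j) (ρ j) (ρ (j + 1))) ∈ W' :=
    fun j => hW' _ _ _ (hmax j).1.1 (hal j)
  have hrsucc : ∀ j, r (j + 1) = norm (ρ (j + 1)) (𝓝.upd (r j) (ρ j) (ρ (j + 1))) :=
    fun j => (hrsucc' j).trans (hcode _ _ (hnorm _ _ (hupd j)).1)
  have hθ1 : ∀ j, θ (ρ (j + 1), 𝓝.upd (r j) (ρ j) (ρ (j + 1))) ≤ θ (ρ j, r j) :=
    fun j => hθle (ρ j, r j) (ρ (j + 1), _) ⟨(hmax j).1.1, hal j, rfl⟩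
  have hθ2 : ∀ j, θ (ρ (j + 1), r (j + 1)) ≤ θ (ρ (j + 1), 𝓝.upd (r j) (ρ j) (ρ (j + 1))) :=
    fun j => (hmax (j + 1)).1.2 _ (hupd j)
  -- Once the rank is constant, overflows stop and every updated state is already minimal, so
  -- normalization only extends it.
  obtain ⟨a, ha⟩ := eventually_const_of_nonincreasing (fun j => θ (ρ j, r j))
    (Eventually.of_forall fun j => (hθ2 j).trans (hθ1 j))
  have htail : ∀ᶠ j in atTop, ¬ G.OverflowAt b (ρ j, r j) (ρ (j + 1)) ∧
      Extends top (𝓝.upd (r j) (ρ j) (ρ (j + 1))) (r (j + 1)) := by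
    filter_upwards [ha, (eventually_atTop_add_iff _ 1).mpr ha] with j hj hj'
    have hle : θ (ρ j, r j) ≤ θ (ρ (j + 1), r (j + 1)) := (hj.trans hj'.symm).le
    refine ⟨fun hov => ?_, ?_⟩
    · have := hθlt (ρ j, r j) (ρ (j + 1), 𝓝.upd (r j) (ρ j) (ρ (j + 1)))
        ⟨(hmax j).1.1, hal j, rfl⟩ hov
      exact absurd (hle.trans (hθ2 j)) (not_le.mpr this)
    · rw [hrsucc]
      exact (hnorm _ _ (hupd j)).2 ⟨hupd j, fun r' hr' =>
        ((hθ1 j).trans hle).trans ((hmax (j + 1)).1.2 r' hr')⟩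
  have hkeep : ∀ᶠ j in atTop, ∀ c, IntervalLe
      (((r j).1.shift (G.w (ρ j) (ρ (j + 1)))).visit (G.Ω (ρ (j + 1))) c)
      ((𝓝.upd (r j) (ρ j) (ρ (j + 1))).1 c) := by
    filter_upwards [htail] with j hj c
    rw [← requestMemory_upd_of_not_overflow hj.1]
    exact le_nest _ c
  refine eventually_cor_le (fun j => (r j).1) hB (htail.mono fun j hj => hj.1) ?_ ?_
  · filter_upwards [htail, hkeep] with j hj hj' c
    exact (hj' c).trans (hj.2.intervalLe c)
  intro c hc hle
  by_contra hfr
  obtain ⟨j₀, hj₀⟩ : ∃ j, G.Ω (ρ j) = c := by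
    by_contra hno
    push Not at hno
    exact hfr (Eventually.of_forall hno)
  -- If the limit superior were the odd color `c`, eventually no even color would reach `top`, so
  -- requests for `top` would never be answered again and its interval could not shrink.
  have hctop : c ≤ top := hle_top ⟨c, hc, ρ j₀, hj₀⟩
  have hsize : ∀ᶠ j in atTop, intervalSize ((r j).1 top) ≤
      intervalSize ((𝓝.upd (r j) (ρ j) (ρ (j + 1))).1 top) := by
    filter_upwards [hkeep, (eventually_atTop_add_iff _ 1).mpr hle] with j hj hj'
    refine (intervalSize_le_of_not_answered _ top ?_).trans (hj top).size_le
    rintro ⟨heven, hge⟩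
    have : G.Ω (ρ (j + 1)) = c := by omega
    rw [this] at heven
    exact absurd hc (Nat.not_odd_iff_even.mpr heven)
  -- Complementing by the maximal size `2 * b + 1` turns growth into descent.
  obtain ⟨s, hs⟩ := eventually_const_of_nonincreasing
    (fun j => 2 * b + 1 - intervalSize ((r j).1 top)) (by
      filter_upwards [htail, hsize] with j hj hj'
      have := hj.2.2.1.size_le
      omega)
  have heq : ∀ᶠ j in atTop, r (j + 1) = 𝓝.upd (r j) (ρ j) (ρ (j + 1)) := by
    filter_upwards [htail, hsize, hs, (eventually_atTop_add_iff _ 1).mpr hs] with j h4 h5 h6 h7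
    refine (h4.2.eq_of_size_le ?_).symm
    have := intervalSize_le (r j) top
    have := intervalSize_le (r (j + 1)) top
    omega
  -- From `n` on, normalization changes nothing, so this tail is a genuine run of the product inside
  -- `W` and satisfies its parity condition.
  obtain ⟨n, hn⟩ := eventually_atTop.mp heq
  have hpar := hgood (fun j => ρ (j + n)) (fun j => r (j + n)) (fun j => (hmax (j + n)).1.1.1)
    (fun j => by
      have : j + 1 + n = j + n + 1 := by omega
      rw [this]
      exact hal (j + n))
    (fun j => by
      have : j + 1 + n = j + n + 1 := by omega
      rw [this]
      exact hn (j + n) (by omega))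
  have hpar' := ((evenLimsup_priority_iff hB).mp hpar).2
  rw [evenLimsup_shift_iff (fun j => G.Ω (ρ j))] at hpar'
  exact hfr (hpar' c hc hle)

end ParityGameWithWeights

/-! ### Assembling the bounds. -/

theorem mainTheorem8 {V : Type*} [Finite V] (G : ParityGameWithWeights V) (v : V) (b : ℕ) :
    ((∃ σ : G.Strategy 0, G.cost₀ v σ = (b : ℕ∞)) →
      (∃ σ' : G.Strategy 0, G.cost₀ v σ' ≤ (b : ℕ∞) ∧
        σ'.HasSize ((2 * b ^ 2 + b + 2) ^ G.numOddColors)) ∧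
      (∃ σ' : G.Strategy 0, G.cost₀ v σ' ≤ (b : ℕ∞) ∧
        σ'.ImplementedBy (G.requestMemory b)) ∧
      Nat.card (G.RequestFunction b) = (2 * b ^ 2 + 3 * b + 2) ^ G.numOddColors) ∧
    ((∃ τ : G.Strategy 1, G.cost₁ v τ = (b : ℕ∞)) →
      ∃ τ' : G.Strategy 1, (b : ℕ∞) ≤ G.cost₁ v τ' ∧
        τ'.HasSize (Nat.card V * (2 * b ^ 2 + 3 * b + 2) ^ G.numOddColors)) := by
  refine ⟨fun ⟨σ, hσ⟩ => ⟨?_, ParityGameWithWeights.exists_requestMemory_strategy hσ.le,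
    ParityGameWithWeights.card_requestFunction⟩,
    fun ⟨τ, hτ⟩ => ParityGameWithWeights.exists_player₁_strategy hτ.ge⟩
  -- Without odd colors there is no top color, and the request memory already has a single state.
  cases hd : G.numOddColors with
  | zero =>
    obtain ⟨σ', h1, h2⟩ := ParityGameWithWeights.exists_requestMemory_strategy hσ.le
    refine ⟨σ', h1, h2.hasSize ?_⟩
    rw [ParityGameWithWeights.card_requestFunction, hd, pow_zero, pow_zero]
  | succ m => exact ParityGameWithWeights.exists_compressed_strategy hσ.le hd
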